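/- Let $1\le m_1\le m_2$ and $N=m_1+m_2$. Consider $N$ bosonic modes with Hilbert space $L^2(\mathbb R^N)$, quadratures $R=(q_1,\dots,q_N,p_1,\dots,p_N)$ with $[q_j,p_k]=i\delta_{jk}$, and Hamiltonian $H=\frac12\sum_{j=1}^N(q_j^2+p_j^2)$. Split the modes into $\mathcal A_1$ ($m_1$ modes) and $\mathcal A_2$ ($m_2$ modes). A pure (displacement-free) Gaussian state is a unit vector $\psi$ with $\langle\psi,e^{i\xi\cdot R}\psi\rangle=e^{-\frac14\xi^{T}\Sigma\xi}$ for all $\xi\in\mathbb R^{2N}$ and some real symmetric $\Sigma$; then $\Sigma_{kl}=\langle R_kR_l+R_lR_k\rangle$ is its covariance matrix. A Gaussian unitary is a unitary $U$ with $U^\dagger RU=SR+d$, $S$ real symplectic and $d$ a real vector. Write $E(\psi)=\langle\psi,H\psi\rangle$ and define the $2$-local ergotropic gap $$\delta(\psi)=\Big(E(\psi)-\min_{U}E(U\psi)\Big)-\Big(E(\psi)-\min_{U_1,U_2}E\big((U_1\otimes U_2)\psi\big)\Big),$$ where $U$ ranges over the Gaussian unitaries on all $N$ modes and $U_i$ over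 the Gaussian unitaries on $\mathcal A_i$. The Rényi-2 entanglement entropy is $S_2(\psi)=-\log\operatorname{Tr}\rho_{1}^2$, where $\rho_{1}$ is the reduced density operator of $\psi$ on $\mathcal A_1$. (1) For every pure Gaussian state $\psi$ the energy $E(\psi)$ is finite, both minima above are attained, and with $\nu_1,\dots,\nu_{m_1}\ge1$ the symplectic eigenvalues of the covariance matrix of $\rho_{1}$, $$S_2(\psi)=\sum_{j=1}^{m_1}\log\nu_j\;\le\;\sum_{j=1}^{m_1}(\nu_j-1)=\delta(\psi),$$ with equality $S_2(\psi)=\delta(\psi)$ if and only if $\psi$ is a product vector $\psi_1\otimes\psi_2$ across $\mathcal A_1|\mathcal A_2$. (2) If $m_1\ge2$, the two quantities are functionally independent: for every $C>1$ there are pure Gaussian states $\psi,\varphi$ with $S_2(\psi)=S_2(\varphi)=\log C$ but $\delta(\psi)=2(\sqrt C-1)\neq C-1=\delta(\varphi)$. Hence there is no function $F:\mathbb R\to\mathbb R$ with $\delta(\psi)=F(S_2(\psi))$ for all pure Gaussian states $\psi$; nor is there a function $G:\mathbb R\to\mathbb R$ with $S_2(\psi)=G(\delta(\psi))$ for all of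 them. -/

import Mathlib

open MeasureTheory Matrix
open scoped ENNReal

namespace GaussianErgotropy

noncomputable section

/-- The Hilbert space of a bosonic system with modes labelled by `ι`: `L²(ℝ^ι; ℂ)`. -/
abbrev L2 (ι : Type) [Fintype ι] : Type := Lp ℂ 2 (volume : Measure (ι → ℝ))

/-- Phase-space indices: `Sum.inl j` is the position `q_j`, `Sum.inr j` the momentum `p_j`. -/
abbrev Phase (ι : Type) : Type := ι ⊕ ι

/-- The function `x ↦ e^{i (u·x + u·v/2)} ψ(x + v)`, where `ξ = (u, v)`. -/
def weylFun {ι : Type} [Fintype ι] (ξ : Phase ι → ℝ) (ψ : (ι → ℝ) → ℂ) (x : ι → ℝ) : ℂ :=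
  Complex.exp (Complex.I *
      (((ξ ∘ Sum.inl) ⬝ᵥ x + (ξ ∘ Sum.inl) ⬝ᵥ (ξ ∘ Sum.inr) / 2 : ℝ) : ℂ)) *
    ψ (x + ξ ∘ Sum.inr)

theorem memLp_weylFun {ι : Type} [Fintype ι] (ξ : Phase ι → ℝ) (ψ : L2 ι) :
    MemLp (weylFun ξ ψ) 2 (volume : Measure (ι → ℝ)) := by
  have h : MemLp (fun x : ι → ℝ => (ψ : (ι → ℝ) → ℂ) (x + ξ ∘ Sum.inr)) 2 volume :=
    (Lp.memLp ψ).comp_measurePreserving (measurePreserving_add_right volume (ξ ∘ Sum.inr))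
  have hc : Continuous fun x : ι → ℝ => Complex.exp (Complex.I *
      (((ξ ∘ Sum.inl) ⬝ᵥ x + (ξ ∘ Sum.inl) ⬝ᵥ (ξ ∘ Sum.inr) / 2 : ℝ) : ℂ)) := by
    unfold dotProduct
    fun_prop
  refine MemLp.of_le h (hc.aestronglyMeasurable.mul h.1) (Filter.Eventually.of_forall fun x => ?_)
  rw [weylFun, norm_mul, mul_comm Complex.I, Complex.norm_exp_ofReal_mul_I, one_mul]

/-- The Weyl operator `exp(i (u·q + v·p))`, `ξ = (u, v)`, on `L²(ℝ^ι)`, with `[q_j, p_k] = i δ_jk`. -/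
def weyl {ι : Type} [Fintype ι] (ξ : Phase ι → ℝ) (ψ : L2 ι) : L2 ι :=
  (memLp_weylFun ξ ψ).toLp (weylFun ξ ψ)

/-- The orbit `t ↦ exp(i t R_k) ψ` of the one-parameter group of the quadrature `R_k`. -/
def orbit {ι : Type} [Fintype ι] [DecidableEq ι] (k : Phase ι) (ψ : L2 ι) (t : ℝ) : L2 ι :=
  weyl (t • Pi.single k 1) ψ

/-- `ψ` is in the domain of the self-adjoint operator `R_k`, which by Stone's theorem is the
generator of `t ↦ exp(i t R_k)`. -/
def InDomain {ι : Type} [Fintype ι] [DecidableEq ι] (k : Phase ι) (ψ : L2 ι) : Prop :=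
  DifferentiableAt ℝ (orbit k ψ) 0

/-- `R_k ψ`, where `R_(inl j) = q_j` and `R_(inr j) = p_j`; meaningful if `InDomain k ψ`. -/
def quad {ι : Type} [Fintype ι] [DecidableEq ι] (k : Phase ι) (ψ : L2 ι) : L2 ι :=
  (-Complex.I) • deriv (orbit k ψ) 0

/-- `⟨R_k²⟩ = ‖R_k ψ‖²`, which is `∞` outside the domain of `R_k`. -/
def secondMoment {ι : Type} [Fintype ι] [DecidableEq ι] (k : Phase ι) (ψ : L2 ι) : ℝ≥0∞ :=
  open Classical in
  if InDomain k ψ then ENNReal.ofReal (‖quad k ψ‖ ^ 2) else ⊤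

/-- The mean energy `⟨H⟩` of the vector state `ψ` for `H = ½ ∑_j (q_j² + p_j²)`. -/
def energy {ι : Type} [Fintype ι] [DecidableEq ι] (ψ : L2 ι) : ℝ≥0∞ :=
  (∑ k : Phase ι, secondMoment k ψ) / 2

/-- The covariance matrix `Σ_kl = ⟨R_k R_l + R_l R_k⟩ - 2 ⟨R_k⟩ ⟨R_l⟩`. -/
def covMatrix {ι : Type} [Fintype ι] [DecidableEq ι] (ψ : L2 ι) :
    Matrix (Phase ι) (Phase ι) ℝ :=
  Matrix.of fun k l => 2 * (inner ℂ (quad k ψ) (quad l ψ)).re -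
    2 * (inner ℂ ψ (quad k ψ)).re * (inner ℂ ψ (quad l ψ)).re

/-- A pure, displacement-free Gaussian state: a unit vector whose characteristic function is a
centred Gaussian. -/
def IsPureGaussian {ι : Type} [Fintype ι] (ψ : L2 ι) : Prop :=
  ‖ψ‖ = 1 ∧ ∃ V : Matrix (Phase ι) (Phase ι) ℝ, V.IsSymm ∧
    ∀ ξ : Phase ι → ℝ, inner ℂ ψ (weyl ξ ψ) = Complex.exp ((-(ξ ⬝ᵥ V *ᵥ ξ) / 4 : ℝ) : ℂ)

/-- A Gaussian unitary: `U† R U = S R + d` with `S` symplectic, written for the exponentials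
`exp(i ξ·R)`. -/
def IsGaussianUnitary {ι : Type} [Fintype ι] [DecidableEq ι] (U : L2 ι ≃ₗᵢ[ℂ] L2 ι) : Prop :=
  ∃ S ∈ Matrix.symplecticGroup ι ℝ, ∃ d : Phase ι → ℝ, ∀ (ξ : Phase ι → ℝ) (ψ : L2 ι),
    weyl ξ (U ψ) = Complex.exp (Complex.I * ((ξ ⬝ᵥ d : ℝ) : ℂ)) • U (weyl (Sᵀ *ᵥ ξ) ψ)

/-- `h = f ⊗ g`, i.e. `h(x, y) = f(x) g(y)` almost everywhere. -/
def IsTensor {ι κ : Type} [Fintype ι] [Fintype κ] (h : L2 (ι ⊕ κ)) (f : L2 ι) (g : L2 κ) : Prop :=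
  (h : (ι ⊕ κ → ℝ) → ℂ) =ᵐ[volume] fun z => f (z ∘ Sum.inl) * g (z ∘ Sum.inr)

/-- `ψ` is a product vector across the cut `ι | κ`. -/
def IsProduct {ι κ : Type} [Fintype ι] [Fintype κ] (ψ : L2 (ι ⊕ κ)) : Prop :=
  ∃ (f : L2 ι) (g : L2 κ), IsTensor ψ f g

/-- `U = U₁ ⊗ U₂` with Gaussian unitaries `U₁` on the modes `ι` and `U₂` on the modes `κ`. -/
def IsLocalGaussianUnitary {ι κ : Type} [Fintype ι] [DecidableEq ι] [Fintype κ] [DecidableEq κ]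
    (U : L2 (ι ⊕ κ) ≃ₗᵢ[ℂ] L2 (ι ⊕ κ)) : Prop :=
  ∃ (U₁ : L2 ι ≃ₗᵢ[ℂ] L2 ι) (U₂ : L2 κ ≃ₗᵢ[ℂ] L2 κ),
    IsGaussianUnitary U₁ ∧ IsGaussianUnitary U₂ ∧
    ∀ (f : L2 ι) (g : L2 κ) (h : L2 (ι ⊕ κ)), IsTensor h f g → IsTensor (U h) (U₁ f) (U₂ g)

/-- Least energy reachable by global Gaussian unitaries. -/
def globalMin {ι : Type} [Fintype ι] [DecidableEq ι] (ψ : L2 ι) : ℝ≥0∞ :=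
  ⨅ (U : L2 ι ≃ₗᵢ[ℂ] L2 ι) (_ : IsGaussianUnitary U), energy (U ψ)

/-- Least energy reachable by Gaussian unitaries that are local for the cut `ι | κ`. -/
def localMin {ι κ : Type} [Fintype ι] [DecidableEq ι] [Fintype κ] [DecidableEq κ]
    (ψ : L2 (ι ⊕ κ)) : ℝ≥0∞ :=
  ⨅ (U : L2 (ι ⊕ κ) ≃ₗᵢ[ℂ] L2 (ι ⊕ κ)) (_ : IsLocalGaussianUnitary U), energy (U ψ)

/-- Global Gaussian ergotropy. -/
def globalErgotropy {ι : Type} [Fintype ι] [DecidableEq ι] (ψ : L2 ι) : ℝ :=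
  (energy ψ).toReal - (globalMin ψ).toReal

/-- `2`-local Gaussian ergotropy. -/
def localErgotropy {ι κ : Type} [Fintype ι] [DecidableEq ι] [Fintype κ] [DecidableEq κ]
    (ψ : L2 (ι ⊕ κ)) : ℝ :=
  (energy ψ).toReal - (localMin ψ).toReal

/-- The `2`-local ergotropic gap. -/
def ergotropicGap {ι κ : Type} [Fintype ι] [DecidableEq ι] [Fintype κ] [DecidableEq κ]
    (ψ : L2 (ι ⊕ κ)) : ℝ :=
  globalErgotropy ψ - localErgotropy ψ

/-- Integral kernel `ρ(x, x') = ∫ ψ(x, y) conj ψ(x', y) dy` of the reduced density operator on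
the modes `ι`. -/
def reducedKernel {ι κ : Type} [Fintype ι] [Fintype κ] (ψ : L2 (ι ⊕ κ)) (x x' : ι → ℝ) : ℂ :=
  ∫ y : κ → ℝ, ψ (Sum.elim x y) * (starRingEnd ℂ) (ψ (Sum.elim x' y))

/-- The purity `Tr ρ² = ∫∫ |ρ(x, x')|² dx dx'` of the reduced density operator on the modes `ι`. -/
def reducedPurity {ι κ : Type} [Fintype ι] [Fintype κ] (ψ : L2 (ι ⊕ κ)) : ℝ :=
  ∫ x : ι → ℝ, ∫ x' : ι → ℝ, ‖reducedKernel ψ x x'‖ ^ 2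

/-- Rényi-2 entanglement entropy of a pure state across `ι | κ`: `-log Tr ρ²` of the reduced
density operator. -/
def renyiTwo {ι κ : Type} [Fintype ι] [Fintype κ] (ψ : L2 (ι ⊕ κ)) : ℝ :=
  -Real.log (reducedPurity ψ)

/-- Covariance matrix of the reduced state on the modes `ι`. -/
def reducedCov {ι κ : Type} [Fintype ι] [DecidableEq ι] [Fintype κ] [DecidableEq κ]
    (ψ : L2 (ι ⊕ κ)) : Matrix (Phase ι) (Phase ι) ℝ :=
  (covMatrix ψ).submatrix (Sum.map Sum.inl Sum.inl) (Sum.map Sum.inl Sum.inl)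

/-- `ν` lists the symplectic eigenvalues of `σ`, with multiplicity (Williamson normal form). -/
def IsSymplecticSpectrum {ι : Type} [Fintype ι] [DecidableEq ι]
    (σ : Matrix (Phase ι) (Phase ι) ℝ) (ν : ι → ℝ) : Prop :=
  (∀ j, 0 < ν j) ∧ ∃ S ∈ Matrix.symplecticGroup ι ℝ,
    S * σ * Sᵀ = Matrix.fromBlocks (Matrix.diagonal ν) 0 0 (Matrix.diagonal ν)

end

end GaussianErgotropy

open GaussianErgotropy

/-!
A pure Gaussian state has purity one, so its covariance matrix `V` has determinant one; together
with the uncertainty relation this forces `V = S Sᵀ` with `S` symplectic. The energy of a centred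
Gaussian vector is `tr V / 4`, and by Williamson's normal form its minimum over a group of Gaussian
unitaries is half the sum of the symplectic eigenvalues available to that group: `N / 2` globally,
and `(∑ ν j + ∑ μ k) / 2` locally, where `ν` and `μ` are the spectra of the two reduced covariance
matrices. The minima are attained already by the unitaries `ψ ↦ |det L|^{1/2} e^{i x·Cx/2} ψ(L x)`,
so no metaplectic representation is needed. Since `V J V = J`, the two spectra agree up to ones,
i.e. `∑ (ν j - 1) = ∑ (μ k - 1)`, and the gap is `∑ (ν j - 1)`.

Plancherel's theorem for characteristic functions turns the reduced purity into a Gaussian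
integral with value `1 / ∏ ν j`. The comparison of entropy and gap is then `log x ≤ x - 1`, with
equality exactly if all `ν j = 1`, in which case a local Gaussian unitary takes the state to the
vacuum. Products of two-mode squeezed vacua realise every spectrum `ν ≥ 1` on pairs of modes, and
prescribing `∏ ν j` does not determine `∑ (ν j - 1)`, nor conversely.
-/

namespace GaussianErgotropy

section SkewAdjoint

open Module RealInnerProductSpace

variable {E : Type*} [NormedAddCommGroup E] [InnerProductSpace ℝ E]

theorem map_mem_orthogonal_of_skew {A : E →ₗ[ℝ] E} (hA : ∀ x y, ⟪A x, y⟫ = -⟪x, A y⟫)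
    {K : Submodule ℝ E} (hK : ∀ x ∈ K, A x ∈ K) {y : E} (hy : y ∈ Kᗮ) : A y ∈ Kᗮ := fun x hx => by
  rw [← neg_eq_zero, ← hA, hy _ (hK x hx)]

theorem orthonormal_sumElim {α β : Type*} {v : α → E} {w : β → E} (hv : Orthonormal ℝ v)
    (hw : Orthonormal ℝ w) (hvw : ∀ a b, ⟪v a, w b⟫ = 0) : Orthonormal ℝ (Sum.elim v w) := by
  refine ⟨Sum.rec hv.1 hw.1, ?_⟩
  rintro (a | a) (b | b) hab
  · exact hv.2 (ne_of_apply_ne _ hab)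
  · exact hvw a b
  · exact (real_inner_comm _ _).trans (hvw b a)
  · exact hw.2 (ne_of_apply_ne _ hab)

variable [FiniteDimensional ℝ E]

/- A unit eigenvector `e` of the symmetric operator `A²` spans, together with `A e`, an invariant
plane. -/
theorem exists_orthonormal_pair_of_skew [Nontrivial E] {A : E →ₗ[ℝ] E}
    (hA : ∀ x y, ⟪A x, y⟫ = -⟪x, A y⟫) (hinj : Function.Injective A) :
    ∃ (b : Fin 2 → E) (ν : ℝ), Orthonormal ℝ b ∧ 0 < ν ∧
      A (b 0) = ν • b 1 ∧ A (b 1) = -(ν • b 0) := by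
  have hsymm : (A ∘ₗ A).IsSymmetric := fun x y => by simp only [LinearMap.comp_apply, hA, neg_neg]
  let i₀ : Fin (finrank ℝ E) := ⟨0, finrank_pos⟩
  let e := hsymm.eigenvectorBasis rfl i₀
  let μ := hsymm.eigenvalues rfl i₀
  have he : ‖e‖ = 1 := (hsymm.eigenvectorBasis rfl).orthonormal.1 i₀
  have hAAe : A (A e) = μ • e := hsymm.apply_eigenvectorBasis rfl i₀
  have hν : 0 < ‖A e‖ := norm_pos_iff.2 fun h =>
    norm_ne_zero_iff.1 (he ▸ one_ne_zero) (hinj (h.trans (map_zero A).symm))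
  have hμ : μ = -‖A e‖ ^ 2 := by
    have h := hA (A e) e
    rwa [hAAe, inner_smul_left, real_inner_self_eq_norm_sq, real_inner_self_eq_norm_sq, he,
      one_pow, mul_one] at h
  have heA : ⟪e, A e⟫ = 0 := by linarith [hA e e, real_inner_comm e (A e)]
  refine ⟨![e, ‖A e‖⁻¹ • A e], ‖A e‖, orthonormal_iff_ite.2 fun i j => ?_, hν, ?_, ?_⟩
  · fin_cases i <;> fin_cases j <;>
      simp [he, hν.ne', norm_smul, inner_smul_left, inner_smul_right, heA,
        real_inner_comm e (A e)]
  · simp [smul_smul, hν.ne']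
  · simp only [Matrix.cons_val_one, Matrix.cons_val_zero, map_smul, hAAe, hμ, smul_smul, ← neg_smul]
    congr 1
    field_simp

theorem exists_orthonormal_basis_of_skew (n : ℕ) : ∀ {E : Type*} [NormedAddCommGroup E]
    [InnerProductSpace ℝ E] [FiniteDimensional ℝ E] {A : E →ₗ[ℝ] E},
    (∀ x y, ⟪A x, y⟫ = -⟪x, A y⟫) → Function.Injective A → finrank ℝ E = 2 * n →
    ∃ (b : Fin n ⊕ Fin n → E) (ν : Fin n → ℝ), Orthonormal ℝ b ∧ ∀ j, 0 < ν j ∧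
      A (b (Sum.inl j)) = ν j • b (Sum.inr j) ∧ A (b (Sum.inr j)) = -(ν j • b (Sum.inl j)) := by
  induction n with
  | zero =>
    intro E _ _ _ A _ _ _
    exact ⟨Sum.elim Fin.elim0 Fin.elim0, Fin.elim0,
      ⟨fun k => k.elim Fin.elim0 Fin.elim0, fun k => k.elim Fin.elim0 Fin.elim0⟩,
      fun j => j.elim0⟩
  | succ n ih =>
    intro E _ _ _ A hA hinj hdim
    have : Nontrivial E := finrank_pos_iff (R := ℝ).1 (by omega)
    obtain ⟨p, ν₀, hp, hν₀, hp0, hp1⟩ := exists_orthonormal_pair_of_skew hA hinj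
    let K : Submodule ℝ E := Submodule.span ℝ (Set.range p)
    have hpK : ∀ i, p i ∈ K := fun i => Submodule.subset_span ⟨i, rfl⟩
    have hKA : K ≤ K.comap A := by
      refine Submodule.span_le.2 (Set.range_subset_iff.2 (Fin.forall_fin_two.2 ⟨?_, ?_⟩))
      · exact (congrArg (· ∈ K) hp0).mpr (K.smul_mem ν₀ (hpK 1))
      · exact (congrArg (· ∈ K) hp1).mpr (K.neg_mem (K.smul_mem ν₀ (hpK 0)))
    have hKdim : finrank ℝ Kᗮ = 2 * n := by
      have h2 : finrank ℝ K = 2 := by simpa using finrank_span_eq_card hp.linearIndependent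
      have := K.finrank_add_finrank_orthogonal
      omega
    obtain ⟨b, ν, hb, hAb⟩ := ih (A := A.restrict fun _ => map_mem_orthogonal_of_skew hA hKA)
      (fun x y => hA x y) (fun x y h => Subtype.ext (hinj (congrArg Subtype.val h))) hKdim
    have hpb : Orthonormal ℝ (Sum.elim p fun k => (b k : E)) :=
      orthonormal_sumElim hp (hb.comp_linearIsometry Kᗮ.subtypeₗᵢ) fun i k => (b k).2 _ (hpK i)
    let g : Fin (n + 1) ⊕ Fin (n + 1) → Fin 2 ⊕ (Fin n ⊕ Fin n) :=
      Sum.elim (Fin.cons (Sum.inl 0) fun j => Sum.inr (Sum.inl j))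
        (Fin.cons (Sum.inl 1) fun j => Sum.inr (Sum.inr j))
    have hg : Function.Injective g := by
      rintro (i | i) (j | j) <;> refine Fin.cases ?_ (fun i => ?_) i <;>
        refine Fin.cases ?_ (fun j => ?_) j <;> simp [g]
    refine ⟨Sum.elim p (fun k => (b k : E)) ∘ g, Fin.cons ν₀ ν, hpb.comp g hg,
      Fin.cases ⟨hν₀, hp0, hp1⟩ fun j => ⟨(hAb j).1, ?_, ?_⟩⟩
    · exact congrArg Subtype.val (hAb j).2.1
    · exact congrArg Subtype.val (hAb j).2.2

end SkewAdjoint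

section Williamson

variable {ι : Type} [Fintype ι] [DecidableEq ι]

theorem exists_isUnit_det_eq_transpose_mul_self {M : Matrix ι ι ℝ} (hM : M.PosDef) :
    ∃ B : Matrix ι ι ℝ, IsUnit B.det ∧ M = Bᵀ * B := by
  open scoped MatrixOrder in
  obtain ⟨B, hB, h⟩ := CStarAlgebra.isStrictlyPositive_iff_eq_star_mul_self.mp
    hM.isStrictlyPositive
  refine ⟨B, (Matrix.isUnit_iff_isUnit_det _).1 hB, ?_⟩
  rw [h, star_eq_conjTranspose, conjTranspose_eq_transpose_of_trivial]

theorem exists_orthogonal_conj_eq_fromBlocks {A : Matrix (Phase ι) (Phase ι) ℝ} (hA : Aᵀ = -A)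
    (hdet : IsUnit A.det) :
    ∃ (O : Matrix (Phase ι) (Phase ι) ℝ) (ν : ι → ℝ), (∀ j, 0 < ν j) ∧ O * Oᵀ = 1 ∧
      O * A * Oᵀ = fromBlocks 0 (-diagonal ν) (diagonal ν) 0 := by
  let E := EuclideanSpace ℝ (Phase ι)
  have inner_eq (x y : E) : inner ℝ x y = x.ofLp ⬝ᵥ y.ofLp := by
    rw [EuclideanSpace.inner_eq_star_dotProduct, dotProduct_comm, star_trivial]
  have skew (x y : E) : inner ℝ (toLpLin 2 2 A x) y = -inner ℝ x (toLpLin 2 2 A y) := by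
    simp only [inner_eq, ofLp_toLpLin, toLin'_apply]
    rw [dotProduct_mulVec, ← mulVec_transpose, hA, neg_mulVec, neg_dotProduct, neg_neg]
  have injective : Function.Injective (toLpLin 2 2 A : E →ₗ[ℝ] E) := fun x y hxy =>
    WithLp.ofLp_injective 2 (mulVec_injective_of_isUnit ((isUnit_iff_isUnit_det _).2 hdet)
      (congrArg WithLp.ofLp hxy))
  obtain ⟨b, ν, hb, hAb⟩ := exists_orthonormal_basis_of_skew (Fintype.card ι) skew injective
    (by simp [E, two_mul])
  let e := Fintype.equivFin ι
  let c : Phase ι → E := b ∘ Sum.map e e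
  have inner_c (k l : Phase ι) : (c k).ofLp ⬝ᵥ (c l).ofLp = (1 : Matrix _ _ ℝ) k l := by
    have hc : Orthonormal ℝ c := hb.comp _ (Sum.map_injective.2 ⟨e.injective, e.injective⟩)
    rw [← inner_eq, orthonormal_iff_ite.1 hc, one_apply]
  have mulVec_inl (j : ι) : A *ᵥ (c (Sum.inl j)).ofLp = ν (e j) • (c (Sum.inr j)).ofLp :=
    congrArg WithLp.ofLp (hAb (e j)).2.1
  have mulVec_inr (j : ι) : A *ᵥ (c (Sum.inr j)).ofLp = -(ν (e j) • (c (Sum.inl j)).ofLp) :=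
    congrArg WithLp.ofLp (hAb (e j)).2.2
  refine ⟨of fun k => (c k).ofLp, ν ∘ e, fun j => (hAb (e j)).1, ext fun k l => inner_c k l,
    ext fun k l => ?_⟩
  have entry : (of (fun k => (c k).ofLp) * A * (of fun k => (c k).ofLp)ᵀ) k l =
      (c k).ofLp ⬝ᵥ A *ᵥ (c l).ofLp := by rw [Matrix.mul_assoc]; rfl
  rw [entry]
  rcases k with i | i <;> rcases l with j | j <;>
    simp only [mulVec_inl, mulVec_inr, dotProduct_neg, dotProduct_smul, inner_c] <;>
    by_cases h : i = j <;> simp [h, one_apply]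

/- If `σ = Bᵀ B`, the orthogonal normal form of `B⁻ᵀ J B⁻¹` has diagonal entries `1 / ν j`. -/
theorem exists_isSymplecticSpectrum {σ : Matrix (Phase ι) (Phase ι) ℝ} (hσ : σ.PosDef) :
    ∃ ν, IsSymplecticSpectrum σ ν := by
  obtain ⟨B, hB, rfl⟩ := exists_isUnit_det_eq_transpose_mul_self hσ
  have hBT : IsUnit Bᵀ.det := by rwa [det_transpose]
  obtain ⟨O, l, hl, hO, hOA⟩ := exists_orthogonal_conj_eq_fromBlocks
    (A := Bᵀ⁻¹ * J ι ℝ * B⁻¹)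
    (by simp only [transpose_mul, transpose_nonsing_inv, transpose_transpose, J_transpose,
      Matrix.mul_assoc, Matrix.neg_mul, Matrix.mul_neg])
    (by
      rw [det_mul, det_mul]
      exact ((isUnit_nonsing_inv_det _ hBT).mul (isUnit_det_J _ _)).mul
        (isUnit_nonsing_inv_det _ hB))
  let d : ι → ℝ := fun j => (√(l j))⁻¹
  let D : Matrix (Phase ι) (Phase ι) ℝ := fromBlocks (diagonal d) 0 0 (diagonal d)
  have hDT : Dᵀ = D := by simp [D]
  have conj_eq (M : Matrix (Phase ι) (Phase ι) ℝ) :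
      D * O * Bᵀ⁻¹ * M * (D * O * Bᵀ⁻¹)ᵀ = D * (O * (Bᵀ⁻¹ * M * B⁻¹) * Oᵀ) * D := by
    simp only [transpose_mul, transpose_nonsing_inv, transpose_transpose, hDT, Matrix.mul_assoc]
  have hdd (j : ι) : d j * d j = (l j)⁻¹ := by
    rw [← mul_inv, Real.mul_self_sqrt (hl j).le]
  have hdld (j : ι) : d j * l j * d j = 1 := by
    rw [mul_right_comm, hdd, inv_mul_cancel₀ (hl j).ne']
  refine ⟨fun j => (l j)⁻¹, fun j => inv_pos.2 (hl j), D * O * Bᵀ⁻¹, ?_, ?_⟩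
  · rw [SymplecticGroup.mem_iff, conj_eq, hOA]
    simp [D, J, fromBlocks_multiply, hdld, -fromBlocks_diagonal, -diagonal_neg]
  · rw [conj_eq, nonsing_inv_mul_cancel_left _ _ hBT, mul_nonsing_inv _ hB, Matrix.mul_one, hO]
    simp [D, hdd]

end Williamson

section Symplectic

variable {ι κ : Type} [Fintype ι] [DecidableEq ι] [Fintype κ] [DecidableEq κ]

theorem isUnit_det_of_mem_symplecticGroup {S : Matrix (Phase ι) (Phase ι) ℝ}
    (hS : S ∈ symplecticGroup ι ℝ) : IsUnit S.det :=
  SymplecticGroup.symplectic_det hS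

theorem inv_mem_symplecticGroup {S : Matrix (Phase ι) (Phase ι) ℝ}
    (hS : S ∈ symplecticGroup ι ℝ) : S⁻¹ ∈ symplecticGroup ι ℝ := by
  rw [← SymplecticGroup.coe_inv' ⟨S, hS⟩]
  exact Subtype.property _

theorem transpose_mul_self_mem_symplecticGroup {S : Matrix (Phase ι) (Phase ι) ℝ}
    (hS : S ∈ symplecticGroup ι ℝ) : Sᵀ * S ∈ symplecticGroup ι ℝ :=
  mul_mem (SymplecticGroup.transpose_mem hS) hS

theorem dotProduct_conj_mulVec {m n : Type*} [Fintype m] [Fintype n] (R : Matrix m n ℝ)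
    (M : Matrix n n ℝ) (x y : m → ℝ) : x ⬝ᵥ (R * M * Rᵀ) *ᵥ y = (Rᵀ *ᵥ x) ⬝ᵥ M *ᵥ (Rᵀ *ᵥ y) := by
  rw [mulVec_transpose R x, ← dotProduct_mulVec, mulVec_mulVec, mulVec_mulVec, Matrix.mul_assoc]

/-- The Robertson–Schrödinger uncertainty relation `σ + i J ≥ 0`, evaluated on the complex
vectors `x + i y` so that it involves real matrices only. -/
def Uncertainty (σ : Matrix (Phase ι) (Phase ι) ℝ) : Prop :=
  ∀ x y : Phase ι → ℝ, 2 * (x ⬝ᵥ J ι ℝ *ᵥ y) ≤ x ⬝ᵥ σ *ᵥ x + y ⬝ᵥ σ *ᵥ y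

theorem uncertainty_one : Uncertainty (1 : Matrix (Phase ι) (Phase ι) ℝ) := fun x y => by
  have hy : (J ι ℝ *ᵥ y) ⬝ᵥ (J ι ℝ *ᵥ y) = y ⬝ᵥ y := by
    rw [dotProduct_mulVec, ← mulVec_transpose, mulVec_mulVec, J_transpose, Matrix.neg_mul,
      J_squared, neg_neg, one_mulVec]
  have h := dotProduct_self_star_nonneg (x - J ι ℝ *ᵥ y)
  rw [star_trivial, sub_dotProduct, dotProduct_sub, dotProduct_sub, hy,
    dotProduct_comm (J ι ℝ *ᵥ y) x] at h
  rw [one_mulVec, one_mulVec]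
  linarith

namespace Uncertainty

variable {σ : Matrix (Phase ι) (Phase ι) ℝ}

theorem conj (h : Uncertainty σ) {R : Matrix (Phase κ) (Phase ι) ℝ}
    (hR : R * J ι ℝ * Rᵀ = J κ ℝ) : Uncertainty (R * σ * Rᵀ) := fun x y => by
  simpa only [← dotProduct_conj_mulVec, hR] using h (Rᵀ *ᵥ x) (Rᵀ *ᵥ y)

theorem submatrix (h : Uncertainty σ) {f : κ → ι} (hf : Function.Injective f) :
    Uncertainty (σ.submatrix (Sum.map f f) (Sum.map f f)) := by
  have conj_eq (M : Matrix (Phase ι) (Phase ι) ℝ) :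
      (1 : Matrix (Phase ι) (Phase ι) ℝ).submatrix (Sum.map f f) id * M *
        ((1 : Matrix (Phase ι) (Phase ι) ℝ).submatrix (Sum.map f f) id)ᵀ =
      M.submatrix (Sum.map f f) (Sum.map f f) := by
    ext k l
    simp [mul_apply, one_apply]
  rw [← conj_eq]
  refine h.conj ((conj_eq _).trans ?_)
  ext (k | k) (l | l) <;> simp [J, one_apply, hf.eq_iff]

theorem two_le_diag_add_diag (h : Uncertainty σ) (j : ι) :
    2 ≤ σ (Sum.inl j) (Sum.inl j) + σ (Sum.inr j) (Sum.inr j) := by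
  simpa [J, add_comm] using h (Pi.single (Sum.inr j) 1) (Pi.single (Sum.inl j) 1)

theorem posDef (h : Uncertainty σ) (hσ : σ.IsSymm) : σ.PosDef := by
  have nonneg (x : Phase ι → ℝ) : 0 ≤ x ⬝ᵥ σ *ᵥ x := by simpa using h x 0
  refine PosDef.of_dotProduct_mulVec_pos (isHermitian_iff_isSymm.2 hσ) fun x hx => ?_
  rw [star_trivial]
  refine (nonneg x).lt_of_ne' fun hx0 => ?_
  let y := -(J ι ℝ *ᵥ x)
  have hxy : x ⬝ᵥ J ι ℝ *ᵥ y = x ⬝ᵥ x := by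
    rw [mulVec_neg, mulVec_mulVec, J_squared, neg_mulVec, neg_neg, one_mulVec]
  have hxx : 0 < x ⬝ᵥ x := by
    simpa only [star_trivial] using dotProduct_self_star_pos_iff.2 hx
  have bound := h ((y ⬝ᵥ σ *ᵥ y / (x ⬝ᵥ x) + 1) • x) y
  rw [mulVec_smul, smul_dotProduct, smul_dotProduct, dotProduct_smul, hx0, hxy, smul_zero,
    smul_zero, zero_add, smul_eq_mul, add_mul, div_mul_cancel₀ _ hxx.ne'] at bound
  linarith [nonneg y]

theorem one_le (h : Uncertainty σ) {ν : ι → ℝ} (hν : IsSymplecticSpectrum σ ν) (j : ι) :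
    1 ≤ ν j := by
  obtain ⟨-, S, hS, hSσ⟩ := hν
  have hj := (h.conj (SymplecticGroup.mem_iff.1 hS)).two_le_diag_add_diag j
  rw [hSσ, fromBlocks_apply₁₁, fromBlocks_apply₂₂, diagonal_apply_eq] at hj
  linarith

end Uncertainty

theorem uncertainty_mul_transpose {S : Matrix (Phase ι) (Phase ι) ℝ}
    (hS : S ∈ symplecticGroup ι ℝ) : Uncertainty (S * Sᵀ) := by
  simpa only [Matrix.mul_one] using uncertainty_one.conj (SymplecticGroup.mem_iff.1 hS)

/- `S + J S J` has Hilbert–Schmidt norm zero, so `S` commutes with `J`. -/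
theorem mul_transpose_eq_one_of_trace_eq {S : Matrix (Phase ι) (Phase ι) ℝ}
    (hS : S ∈ symplecticGroup ι ℝ) (h : (S * Sᵀ).trace = 2 * Fintype.card ι) : S * Sᵀ = 1 := by
  have hJ : J ι ℝ * J ι ℝ = -1 := J_squared ι ℝ
  have hSJ : S * (J ι ℝ * Sᵀ) = J ι ℝ := by rw [← Matrix.mul_assoc, SymplecticGroup.mem_iff.1 hS]
  have hSJJ : S * (J ι ℝ * (Sᵀ * J ι ℝ)) = -1 := by
    rw [← hJ, ← Matrix.mul_assoc (J ι ℝ), ← Matrix.mul_assoc, hSJ]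
  have hJJS : J ι ℝ * (S * (J ι ℝ * (J ι ℝ * (Sᵀ * J ι ℝ)))) = -(J ι ℝ * (S * Sᵀ * J ι ℝ)) := by
    rw [← Matrix.mul_assoc (J ι ℝ) (J ι ℝ), hJ, Matrix.neg_mul, Matrix.one_mul, Matrix.mul_neg,
      Matrix.mul_neg, Matrix.mul_assoc]
  have gram : (S + J ι ℝ * S * J ι ℝ) * (S + J ι ℝ * S * J ι ℝ)ᵀ =
      S * Sᵀ - J ι ℝ * (S * Sᵀ * J ι ℝ) - 1 - 1 := by
    simp only [transpose_add, transpose_mul, J_transpose, Matrix.add_mul, Matrix.mul_add,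
      Matrix.neg_mul, Matrix.mul_neg, neg_neg, Matrix.mul_assoc, hSJ, hSJJ, hJ] at hJJS ⊢
    rw [hJJS]
    abel
  have trace_conj : (J ι ℝ * (S * Sᵀ * J ι ℝ)).trace = -(S * Sᵀ).trace := by
    rw [trace_mul_comm, Matrix.mul_assoc, hJ, Matrix.mul_neg, Matrix.mul_one, trace_neg]
  have commute : S + J ι ℝ * S * J ι ℝ = 0 := by
    rw [← trace_mul_conjTranspose_self_eq_zero_iff, conjTranspose_eq_transpose_of_trivial, gram,
      trace_sub, trace_sub, trace_sub, trace_conj, h, trace_one, Fintype.card_sum]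
    push_cast
    ring
  calc S * Sᵀ = -(J ι ℝ * S * J ι ℝ) * Sᵀ := by rw [← eq_neg_of_add_eq_zero_left commute]
    _ = 1 := by rw [Matrix.neg_mul, Matrix.mul_assoc, Matrix.mul_assoc, hSJ, hJ, neg_neg]

namespace IsSymplecticSpectrum

variable {σ : Matrix (Phase ι) (Phase ι) ℝ} {ν : ι → ℝ}

theorem exists_eq_conj (h : IsSymplecticSpectrum σ ν) : ∃ T ∈ symplecticGroup ι ℝ,
    σ = T * diagonal (Sum.elim ν ν) * Tᵀ := by
  obtain ⟨-, S, hS, hSσ⟩ := h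
  have hu := isUnit_det_of_mem_symplecticGroup hS
  refine ⟨S⁻¹, inv_mem_symplecticGroup hS, ?_⟩
  rw [← fromBlocks_diagonal, ← hSσ, transpose_nonsing_inv, Matrix.mul_assoc S,
    nonsing_inv_mul_cancel_left _ _ hu, Matrix.mul_assoc,
    mul_nonsing_inv _ (by rwa [det_transpose]), Matrix.mul_one]

theorem det_eq (h : IsSymplecticSpectrum σ ν) : σ.det = (∏ j, ν j) ^ 2 := by
  obtain ⟨T, hT, rfl⟩ := h.exists_eq_conj
  rw [det_mul, det_mul, det_transpose, SymplecticGroup.det_eq_one hT, det_diagonal,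
    Fintype.prod_sum_type, one_mul, mul_one, sq]
  rfl

/- With `σ = T diag(ν, ν) Tᵀ` and `M = S T`, the trace is `∑ ν j ((Mᵀ M) j j + (Mᵀ M) j' j')`. -/
theorem two_mul_sum_le_trace (h : IsSymplecticSpectrum σ ν) {S : Matrix (Phase ι) (Phase ι) ℝ}
    (hS : S ∈ symplecticGroup ι ℝ) : 2 * ∑ j, ν j ≤ (S * σ * Sᵀ).trace := by
  obtain ⟨T, hT, rfl⟩ := h.exists_eq_conj
  let G := (S * T)ᵀ * (S * T)
  have hG : Uncertainty G := by
    simpa only [G, transpose_transpose] using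
      uncertainty_mul_transpose (SymplecticGroup.transpose_mem (mul_mem hS hT))
  have trace_eq : (S * (T * diagonal (Sum.elim ν ν) * Tᵀ) * Sᵀ).trace =
      (G * diagonal (Sum.elim ν ν)).trace := by
    have assoc : S * (T * diagonal (Sum.elim ν ν) * Tᵀ) * Sᵀ =
        S * T * (diagonal (Sum.elim ν ν) * (S * T)ᵀ) := by
      simp only [transpose_mul, Matrix.mul_assoc]
    rw [assoc, trace_mul_comm, trace_mul_comm G, Matrix.mul_assoc]
  calc 2 * ∑ j, ν j = ∑ j, 2 * ν j := Finset.mul_sum ..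
    _ ≤ ∑ j, (G (Sum.inl j) (Sum.inl j) + G (Sum.inr j) (Sum.inr j)) * ν j :=
      Finset.sum_le_sum fun j _ =>
        mul_le_mul_of_nonneg_right (hG.two_le_diag_add_diag j) (h.1 j).le
    _ = (S * (T * diagonal (Sum.elim ν ν) * Tᵀ) * Sᵀ).trace := by
      rw [trace_eq]
      simp only [trace, diag_apply, mul_diagonal, Fintype.sum_sum_type, Sum.elim_inl,
        Sum.elim_inr, add_mul, Finset.sum_add_distrib]

end IsSymplecticSpectrum

/- This is how the purity of a state makes its covariance matrix symplectic: the symplectic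
eigenvalues are at least one and their product is one. -/
theorem Uncertainty.exists_eq_mul_transpose_of_det_eq_one {V : Matrix (Phase ι) (Phase ι) ℝ}
    (hV : Uncertainty V) (hsymm : V.IsSymm) (hdet : V.det = 1) :
    ∃ S ∈ symplecticGroup ι ℝ, V = S * Sᵀ := by
  obtain ⟨ν, hν⟩ := exists_isSymplecticSpectrum (hV.posDef hsymm)
  have hprod : ∏ j, ν j = 1 := by
    rw [← sq_eq_sq₀ (Finset.prod_nonneg fun j _ => (hν.1 j).le) zero_le_one, one_pow, ← hν.det_eq,
      hdet]
  have hone : ν = 1 := funext fun j => by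
    refine (hV.one_le hν j).eq_or_lt'.resolve_right fun hj => hprod.not_gt ?_
    simpa using Finset.prod_lt_prod (fun _ _ => one_pos) (fun i _ => hV.one_le hν i)
      ⟨j, Finset.mem_univ j, hj⟩
  obtain ⟨T, hT, hVT⟩ := hν.exists_eq_conj
  refine ⟨T, hT, ?_⟩
  simp [hVT, hone]

end Symplectic

section Bipartite

variable {ι κ : Type}

/-- The covariance block of the first subsystem. -/
def leftBlock (V : Matrix (Phase (ι ⊕ κ)) (Phase (ι ⊕ κ)) ℝ) : Matrix (Phase ι) (Phase ι) ℝ :=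
  V.submatrix (Sum.map Sum.inl Sum.inl) (Sum.map Sum.inl Sum.inl)

/-- The covariance block of the second subsystem. -/
def rightBlock (V : Matrix (Phase (ι ⊕ κ)) (Phase (ι ⊕ κ)) ℝ) : Matrix (Phase κ) (Phase κ) ℝ :=
  V.submatrix (Sum.map Sum.inr Sum.inr) (Sum.map Sum.inr Sum.inr)

/-- The block of correlations between the two subsystems. -/
def crossBlock (V : Matrix (Phase (ι ⊕ κ)) (Phase (ι ⊕ κ)) ℝ) : Matrix (Phase ι) (Phase κ) ℝ :=
  V.submatrix (Sum.map Sum.inl Sum.inl) (Sum.map Sum.inr Sum.inr)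

/-- The direct sum of phase-space matrices of two subsystems. -/
def dirSum (S : Matrix (Phase ι) (Phase ι) ℝ) (T : Matrix (Phase κ) (Phase κ) ℝ) :
    Matrix (Phase (ι ⊕ κ)) (Phase (ι ⊕ κ)) ℝ :=
  (fromBlocks S 0 0 T).submatrix (Equiv.sumSumSumComm ι κ ι κ) (Equiv.sumSumSumComm ι κ ι κ)

theorem dirSum_transpose (S : Matrix (Phase ι) (Phase ι) ℝ) (T : Matrix (Phase κ) (Phase κ) ℝ) :
    (dirSum S T)ᵀ = dirSum Sᵀ Tᵀ := by
  simp only [dirSum, transpose_submatrix, fromBlocks_transpose, transpose_zero]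

theorem J_eq_dirSum [DecidableEq ι] [DecidableEq κ] : J (ι ⊕ κ) ℝ = dirSum (J ι ℝ) (J κ ℝ) := by
  ext ((a | a) | (a | a)) ((b | b) | (b | b)) <;> simp [dirSum, J, one_apply]

theorem eq_submatrix_fromBlocks {V : Matrix (Phase (ι ⊕ κ)) (Phase (ι ⊕ κ)) ℝ} (hV : V.IsSymm) :
    V = (fromBlocks (leftBlock V) (crossBlock V) (crossBlock V)ᵀ (rightBlock V)).submatrix
      (Equiv.sumSumSumComm ι κ ι κ) (Equiv.sumSumSumComm ι κ ι κ) := by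
  ext ((a | a) | (a | a)) ((b | b) | (b | b)) <;>
    first | rfl | exact hV.apply _ _

variable [Fintype ι] [Fintype κ]

theorem trace_dirSum_conj (S : Matrix (Phase ι) (Phase ι) ℝ) (T : Matrix (Phase κ) (Phase κ) ℝ)
    {V : Matrix (Phase (ι ⊕ κ)) (Phase (ι ⊕ κ)) ℝ} (hV : V.IsSymm) :
    (dirSum S T * V * (dirSum S T)ᵀ).trace =
      (S * leftBlock V * Sᵀ).trace + (T * rightBlock V * Tᵀ).trace := by
  conv_lhs => rw [eq_submatrix_fromBlocks hV]
  rw [dirSum_transpose, dirSum, dirSum, submatrix_mul_equiv, submatrix_mul_equiv,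
    fromBlocks_multiply, fromBlocks_multiply]
  simp only [Matrix.zero_mul, Matrix.mul_zero, add_zero, zero_add]
  exact ((Equiv.sumSumSumComm ι κ ι κ).sum_comp fun k => fromBlocks _ _ _ _ k k).trans
    (Fintype.sum_sum_type _)

variable [DecidableEq ι] [DecidableEq κ]

theorem IsSymplecticSpectrum.charpoly_eq {σ : Matrix (Phase ι) (Phase ι) ℝ} {ν : ι → ℝ}
    (h : IsSymplecticSpectrum σ ν) : (-(J ι ℝ * σ * (J ι ℝ * σ)) - 1).charpoly =
      (∏ j, (Polynomial.X - Polynomial.C (ν j ^ 2 - 1))) ^ 2 := by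
  obtain ⟨T, hT, rfl⟩ := h.exists_eq_conj
  let D : Matrix (Phase ι) (Phase ι) ℝ := diagonal (Sum.elim ν ν)
  have hTT : IsUnit Tᵀ.det := by
    rw [det_transpose]
    exact isUnit_det_of_mem_symplecticGroup hT
  have hTJ : Tᵀ * (J ι ℝ * T) = J ι ℝ := by
    rw [← Matrix.mul_assoc, SymplecticGroup.mem_iff'.1 hT]
  have hJDJD : J ι ℝ * (D * (J ι ℝ * D)) = -(D * D) := by
    simp only [D, ← fromBlocks_diagonal, J, fromBlocks_multiply, fromBlocks_neg]
    simp
  have intertwine : Tᵀ * (-(J ι ℝ * (T * D * Tᵀ) * (J ι ℝ * (T * D * Tᵀ))) - 1) =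
      (D * D - 1) * Tᵀ := by
    have : Tᵀ * (J ι ℝ * (T * D * Tᵀ) * (J ι ℝ * (T * D * Tᵀ))) =
        Tᵀ * (J ι ℝ * T) * (D * (Tᵀ * (J ι ℝ * T) * D)) * Tᵀ := by
      simp only [Matrix.mul_assoc]
    rw [Matrix.mul_sub, Matrix.mul_neg, this, hTJ, hJDJD, Matrix.mul_one, Matrix.neg_mul, neg_neg,
      Matrix.sub_mul, Matrix.one_mul]
  have hDD : D * D - 1 = diagonal (Sum.elim (fun j => ν j ^ 2 - 1) fun j => ν j ^ 2 - 1) := by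
    ext (i | i) (j | j) <;> by_cases hij : i = j <;> simp [D, one_apply, hij, sq]
  calc _ = (Tᵀ⁻¹ * ((D * D - 1) * Tᵀ)).charpoly := by
        rw [← intertwine, nonsing_inv_mul_cancel_left _ _ hTT]
    _ = (D * D - 1).charpoly := by
        rw [charpoly_mul_comm, Matrix.mul_assoc, mul_nonsing_inv _ hTT, Matrix.mul_one]
    _ = _ := by
        rw [hDD, charpoly_diagonal, Fintype.prod_sum_type, sq]
        rfl

/- The diagonal blocks of `V J V = J` give `-(J σ)² - 1 = (J γ) (J γᵀ)` and
`-(J τ)² - 1 = (J γᵀ) (J γ)`, and `A B`, `B A` have the same nonzero spectrum. -/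
theorem charpoly_block_eq {V : Matrix (Phase (ι ⊕ κ)) (Phase (ι ⊕ κ)) ℝ} (hV : V.IsSymm)
    (hVJ : V ∈ symplecticGroup (ι ⊕ κ) ℝ) :
    Polynomial.X ^ Fintype.card (Phase κ) *
        (-(J ι ℝ * leftBlock V * (J ι ℝ * leftBlock V)) - 1).charpoly =
      Polynomial.X ^ Fintype.card (Phase ι) *
        (-(J κ ℝ * rightBlock V * (J κ ℝ * rightBlock V)) - 1).charpoly := by
  set σ := leftBlock V
  set τ := rightBlock V
  set γ := crossBlock V
  let e := Equiv.sumSumSumComm ι κ ι κ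
  have hblocks : fromBlocks σ γ γᵀ τ * fromBlocks (J ι ℝ) 0 0 (J κ ℝ) * fromBlocks σ γ γᵀ τ =
      fromBlocks (J ι ℝ) 0 0 (J κ ℝ) := by
    refine (reindex e.symm e.symm).injective ?_
    simp only [reindex_apply, Equiv.symm_symm]
    rw [← submatrix_mul_equiv _ _ _ e, ← submatrix_mul_equiv _ _ _ e,
      ← eq_submatrix_fromBlocks hV]
    change V * dirSum _ _ * V = dirSum _ _
    rw [← J_eq_dirSum]
    simpa only [hV.eq] using SymplecticGroup.mem_iff.1 hVJ
  simp only [fromBlocks_multiply, Matrix.mul_zero, zero_add, add_zero] at hblocks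
  obtain ⟨hσ, -, -, hτ⟩ := fromBlocks_inj.1 hblocks
  have left_eq : -(J ι ℝ * σ * (J ι ℝ * σ)) - 1 = J ι ℝ * γ * (J κ ℝ * γᵀ) := by
    have := congrArg (J ι ℝ * ·) hσ
    simp only [Matrix.mul_add, J_squared, Matrix.mul_assoc] at this ⊢
    rw [sub_eq_add_neg, ← this, neg_add_cancel_left]
  have right_eq : -(J κ ℝ * τ * (J κ ℝ * τ)) - 1 = J κ ℝ * γᵀ * (J ι ℝ * γ) := by
    have := congrArg (J κ ℝ * ·) hτ
    simp only [Matrix.mul_add, J_squared, Matrix.mul_assoc] at this ⊢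
    rw [sub_eq_add_neg, ← this]
    abel
  rw [left_eq, right_eq, charpoly_mul_comm']

theorem sum_sub_one_eq_of_isSymplecticSpectrum {V : Matrix (Phase (ι ⊕ κ)) (Phase (ι ⊕ κ)) ℝ}
    (hV : V.IsSymm) (hVJ : V ∈ symplecticGroup (ι ⊕ κ) ℝ) {ν : ι → ℝ} {μ : κ → ℝ}
    (hν : IsSymplecticSpectrum (leftBlock V) ν) (hμ : IsSymplecticSpectrum (rightBlock V) μ) :
    ∑ j, (μ j - 1) = ∑ j, (ν j - 1) := by
  have roots_prod {α : Type} [Fintype α] (d : α → ℝ) :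
      (∏ i, (Polynomial.X - Polynomial.C (d i))).roots = Finset.univ.val.map d := by
    rw [← Polynomial.roots_multiset_prod_X_sub_C (Finset.univ.val.map d), Multiset.map_map]
    rfl
  have prod_ne_zero {α : Type} [Fintype α] (d : α → ℝ) :
      (∏ i, (Polynomial.X - Polynomial.C (d i))) ^ 2 ≠ 0 :=
    pow_ne_zero _ (Polynomial.monic_prod_X_sub_C d Finset.univ).ne_zero
  have sum_sqrt {α : Type} [Fintype α] {d : α → ℝ} (hd : ∀ j, 0 < d j) :
      ((Finset.univ.val.map fun j => d j ^ 2 - 1).map fun t => √(1 + t) - 1).sum =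
        ∑ j, (d j - 1) := by
    rw [Multiset.map_map]
    exact Finset.sum_congr rfl fun j _ => by
      rw [Function.comp_apply, add_sub_cancel, Real.sqrt_sq (hd j).le]
  have hroots := congrArg Polynomial.roots (charpoly_block_eq hV hVJ)
  rw [hν.charpoly_eq, hμ.charpoly_eq,
    Polynomial.roots_mul (mul_ne_zero (pow_ne_zero _ Polynomial.X_ne_zero) (prod_ne_zero _)),
    Polynomial.roots_mul (mul_ne_zero (pow_ne_zero _ Polynomial.X_ne_zero) (prod_ne_zero _)),
    Polynomial.roots_X_pow, Polynomial.roots_X_pow, Polynomial.roots_pow, Polynomial.roots_pow,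
    roots_prod, roots_prod] at hroots
  have hsum := congrArg (fun m : Multiset ℝ => (m.map fun t => √(1 + t) - 1).sum) hroots
  simp only [Multiset.map_add, Multiset.sum_add, Multiset.map_nsmul, Multiset.sum_nsmul,
    Multiset.map_singleton, Multiset.sum_singleton, add_zero, Real.sqrt_one, sub_self, smul_zero,
    zero_add, sum_sqrt hν.1, sum_sqrt hμ.1, nsmul_eq_mul] at hsum
  push_cast at hsum
  linarith

end Bipartite

section Triangular

variable {ι κ : Type} [Fintype ι] [DecidableEq ι] [Fintype κ] [DecidableEq κ]

/-- The phase-space matrix `[[L⁻¹, 0], [C L⁻¹, Lᵀ]]` of a linear change of variables followed by a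
quadratic phase. -/
noncomputable def triMat (L C : Matrix ι ι ℝ) : Matrix (Phase ι) (Phase ι) ℝ :=
  fromBlocks L⁻¹ 0 (C * L⁻¹) Lᵀ

theorem triMat_mem_symplecticGroup {L C : Matrix ι ι ℝ} (hL : IsUnit L.det) (hC : C.IsSymm) :
    triMat L C ∈ symplecticGroup ι ℝ := by
  rw [triMat, SymplecticGroup.fromBlocks_mem_iff]
  refine ⟨?_, ?_, ?_⟩
  · rw [transpose_mul, hC.eq, Matrix.mul_assoc]
  · simp
  · simp [← transpose_mul, mul_nonsing_inv _ hL]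

theorem triMat_fromBlocks {L C : Matrix ι ι ℝ} {L' C' : Matrix κ κ ℝ} (hL : IsUnit L.det)
    (hL' : IsUnit L'.det) :
    triMat (fromBlocks L 0 0 L') (fromBlocks C 0 0 C') = dirSum (triMat L C) (triMat L' C') := by
  have hinv : (fromBlocks L 0 0 L')⁻¹ = fromBlocks L⁻¹ 0 0 L'⁻¹ :=
    inv_eq_right_inv (by
      rw [fromBlocks_multiply, mul_nonsing_inv _ hL, mul_nonsing_inv _ hL']
      simp)
  rw [triMat, hinv, fromBlocks_multiply, fromBlocks_transpose, dirSum, triMat, triMat]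
  ext ((a | a) | (a | a)) ((b | b) | (b | b)) <;> simp

theorem isSymm_conj_of_mul_eq {B X : Matrix ι ι ℝ} (hB : IsUnit B.det)
    (hX : Xᵀ * (Bᵀ * B) = Bᵀ * B * X) : (B * X * B⁻¹).IsSymm :=
  have hBT : IsUnit Bᵀ.det := by rwa [det_transpose]
  calc (B * X * B⁻¹)ᵀ = Bᵀ⁻¹ * (Xᵀ * (Bᵀ * B)) * B⁻¹ := by
        rw [transpose_mul, transpose_mul, transpose_nonsing_inv, Matrix.mul_assoc _ _ B⁻¹,
          Matrix.mul_assoc _ _ B⁻¹, Matrix.mul_assoc _ _ B⁻¹, mul_nonsing_inv _ hB, Matrix.mul_one]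
    _ = B * X * B⁻¹ := by rw [hX, Matrix.mul_assoc Bᵀ, nonsing_inv_mul_cancel_left _ _ hBT]

theorem transpose_mul_triMat_eq_fromBlocks {A B X : Matrix ι ι ℝ} (hB : IsUnit B.det)
    (hX : Xᵀ * (Bᵀ * B) = Bᵀ * B * X) (hA : A * (Bᵀ * B) - X * X = 1) :
    (triMat Bᵀ (B * X * B⁻¹))ᵀ * triMat Bᵀ (B * X * B⁻¹) = fromBlocks A X Xᵀ (Bᵀ * B) := by
  have hBT : IsUnit Bᵀ.det := by rwa [det_transpose]
  have lower_left : (B * X * B⁻¹ * Bᵀ⁻¹)ᵀ = X * B⁻¹ := by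
    rw [transpose_mul, (isSymm_conj_of_mul_eq hB hX).eq, transpose_nonsing_inv, transpose_transpose,
      Matrix.mul_assoc B, nonsing_inv_mul_cancel_left _ _ hB]
  have gram_upper_right : X * B⁻¹ * B = X := nonsing_inv_mul_cancel_right _ _ hB
  have gram_lower_left : Bᵀ * (B * X * B⁻¹ * Bᵀ⁻¹) = Xᵀ := by
    rw [← transpose_transpose (B * X * B⁻¹ * Bᵀ⁻¹), lower_left, ← transpose_mul, gram_upper_right]
  have gram_upper_left : B⁻¹ * Bᵀ⁻¹ + X * B⁻¹ * (B * X * B⁻¹ * Bᵀ⁻¹) = A :=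
    calc _ = (1 + X * X) * (B⁻¹ * Bᵀ⁻¹) := by
          simp only [Matrix.add_mul, Matrix.one_mul, Matrix.mul_assoc,
            nonsing_inv_mul_cancel_left _ _ hB]
      _ = A * (Bᵀ * B) * (B⁻¹ * Bᵀ⁻¹) := by rw [← hA, sub_add_cancel]
      _ = A := by
          rw [Matrix.mul_assoc, Matrix.mul_assoc Bᵀ, mul_nonsing_inv_cancel_left _ _ hB,
            mul_nonsing_inv _ hBT, Matrix.mul_one]
  rw [triMat, fromBlocks_transpose, fromBlocks_multiply, lower_left, transpose_nonsing_inv,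
    transpose_transpose, gram_upper_left, gram_upper_right, gram_lower_left]
  simp

/- Write `Sᵀ S = [[A, X], [Xᵀ, Bᵀ B]]`; being symplectic means that `Bᵀ B X` is symmetric and
`A Bᵀ B - X X = 1`. -/
theorem exists_triMat_transpose_mul_self_eq {S : Matrix (Phase ι) (Phase ι) ℝ}
    (hS : S ∈ symplecticGroup ι ℝ) : ∃ L C : Matrix ι ι ℝ, IsUnit L.det ∧ C.IsSymm ∧
      (triMat L C)ᵀ * triMat L C = Sᵀ * S := by
  have hW := transpose_mul_self_mem_symplecticGroup hS
  have hsymm : (Sᵀ * S).IsSymm := isSymm_transpose_mul_self S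
  have hpos : (Sᵀ * S).PosDef := by
    simpa only [transpose_transpose] using
      (uncertainty_mul_transpose (SymplecticGroup.transpose_mem hS)).posDef
        (isSymm_mul_transpose_self _)
  set W := Sᵀ * S
  obtain ⟨B, hB, hQ⟩ : ∃ B : Matrix ι ι ℝ, IsUnit B.det ∧ W.toBlocks₂₂ = Bᵀ * B :=
    exists_isUnit_det_eq_transpose_mul_self (hpos.submatrix Sum.inr_injective)
  have hA : W.toBlocks₁₁ᵀ = W.toBlocks₁₁ := ext fun i j => hsymm.apply _ _
  have hX : W.toBlocks₁₂ᵀ = W.toBlocks₂₁ := ext fun i j => hsymm.apply _ _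
  have blocks : W = fromBlocks W.toBlocks₁₁ W.toBlocks₁₂ W.toBlocks₁₂ᵀ (Bᵀ * B) := by
    rw [← hQ, hX, fromBlocks_toBlocks]
  rw [blocks, SymplecticGroup.fromBlocks_mem_iff, transpose_mul, transpose_transpose,
    transpose_transpose, hA] at hW
  exact ⟨Bᵀ, B * W.toBlocks₁₂ * B⁻¹, by rwa [det_transpose], isSymm_conj_of_mul_eq hB hW.2.1,
    (transpose_mul_triMat_eq_fromBlocks hB hW.2.1 hW.2.2).trans blocks.symm⟩

theorem IsSymplecticSpectrum.exists_triMat_trace_eq {σ : Matrix (Phase ι) (Phase ι) ℝ}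
    {ν : ι → ℝ} (h : IsSymplecticSpectrum σ ν) : ∃ L C : Matrix ι ι ℝ, IsUnit L.det ∧ C.IsSymm ∧
      (triMat L C * σ * (triMat L C)ᵀ).trace = 2 * ∑ j, ν j := by
  obtain ⟨-, S, hS, hSσ⟩ := h
  obtain ⟨L, C, hL, hC, hLC⟩ := exists_triMat_transpose_mul_self_eq hS
  refine ⟨L, C, hL, hC, ?_⟩
  rw [trace_mul_comm, ← Matrix.mul_assoc, hLC, Matrix.mul_assoc, trace_mul_comm, hSσ,
    fromBlocks_diagonal, trace_diagonal, Fintype.sum_sum_type, two_mul]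
  rfl

end Triangular

section Plancherel

open scoped FourierTransform

theorem fourier_toLp_ae_eq {E : Type*} [NormedAddCommGroup E] [InnerProductSpace ℝ E]
    [FiniteDimensional ℝ E] [MeasurableSpace E] [BorelSpace E] {f : E → ℂ}
    (hf₁ : Integrable f) (hf₂ : MemLp f 2) :
    (𝓕 (hf₂.toLp f) : Lp ℂ 2 (volume : Measure E)) =ᵐ[volume] 𝓕 f := by
  have hcont : Continuous fun p : E × E => innerₗ E p.1 p.2 := continuous_inner
  refine ae_eq_of_integral_contDiff_smul_eq
    ((Lp.memLp (𝓕 (hf₂.toLp f))).locallyIntegrable one_le_two)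
    (VectorFourier.fourierIntegral_continuous Real.continuous_fourierChar hcont hf₁
      ).locallyIntegrable fun g hg hgc => ?_
  let γ : SchwartzMap E ℂ := (hgc.comp_left Complex.ofReal_zero).toSchwartzMap
    (Complex.ofRealCLM.contDiff.comp hg)
  have hγ (x : E) (z : ℂ) : g x • z = γ x • z := Complex.real_smul
  simp only [hγ]
  calc ∫ x, γ x • (𝓕 (hf₂.toLp f) : Lp ℂ 2 (volume : Measure E)) x
      = Lp.toTemperedDistribution (𝓕 (hf₂.toLp f)) γ :=
        (Lp.toTemperedDistribution_apply _ _).symm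
    _ = Lp.toTemperedDistribution (hf₂.toLp f) (𝓕 γ) := by
      rw [← Lp.fourier_toTemperedDistribution_eq, TemperedDistribution.fourier_apply]
    _ = ∫ x, 𝓕 (γ : E → ℂ) x • f x := by
      rw [Lp.toTemperedDistribution_apply]
      refine integral_congr_ae ?_
      filter_upwards [hf₂.coeFn_toLp] with x hx
      rw [hx, SchwartzMap.fourier_coe]
    _ = ∫ x, γ x • 𝓕 f x := by
      refine (VectorFourier.integral_fourierIntegral_smul_eq_flip Real.continuous_fourierChar
        hcont γ.integrable hf₁).trans ?_
      rw [flip_innerₗ]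
      rfl

theorem lintegral_enorm_sq_eq {α F : Type*} [MeasurableSpace α] [NormedAddCommGroup F]
    {μ : Measure α} (f : α → F) : ∫⁻ x, ‖f x‖ₑ ^ 2 ∂μ = eLpNorm f 2 μ ^ 2 := by
  simpa using (eLpNorm_nnreal_pow_eq_lintegral (f := f) (μ := μ) (p := 2) two_ne_zero).symm

theorem lintegral_enorm_fourier_sq {E : Type*} [NormedAddCommGroup E] [InnerProductSpace ℝ E]
    [FiniteDimensional ℝ E] [MeasurableSpace E] [BorelSpace E] {f : E → ℂ}
    (hf₁ : Integrable f) (hf₂ : MemLp f 2) : ∫⁻ w, ‖𝓕 f w‖ₑ ^ 2 = ∫⁻ x, ‖f x‖ₑ ^ 2 := by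
  have h : eLpNorm (𝓕 f) 2 volume = eLpNorm f 2 volume := by
    rw [← eLpNorm_congr_ae (fourier_toLp_ae_eq hf₁ hf₂), ← Lp.enorm_def,
      ← eLpNorm_congr_ae hf₂.coeFn_toLp, ← Lp.enorm_def, ← ofReal_norm, Lp.norm_fourier_eq,
      ofReal_norm]
  rw [lintegral_enorm_sq_eq, lintegral_enorm_sq_eq, h]

variable {ι : Type} [Fintype ι]

/-- The Fourier transform `u ↦ ∫ e^{i u·x} f(x) dx` on `ℝ^ι`, in the normalisation of
characteristic functions. -/
noncomputable def expIntegral (f : (ι → ℝ) → ℂ) (u : ι → ℝ) : ℂ :=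
  ∫ x, Complex.exp (Complex.I * ((u ⬝ᵥ x : ℝ) : ℂ)) * f x

theorem lintegral_enorm_expIntegral_sq {f : (ι → ℝ) → ℂ} (hf₁ : Integrable f)
    (hf₂ : MemLp f 2) : ∫⁻ u, ‖expIntegral f u‖ₑ ^ 2 =
      ENNReal.ofReal ((2 * Real.pi) ^ Fintype.card ι) * ∫⁻ x, ‖f x‖ₑ ^ 2 := by
  have hofLp := PiLp.volume_preserving_ofLp ι
  have he := (MeasurableEquiv.toLp 2 (ι → ℝ)).symm.measurableEmbedding
  have hfourier (w : EuclideanSpace ℝ ι) :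
      𝓕 (f ∘ WithLp.ofLp : EuclideanSpace ℝ ι → ℂ) w =
        expIntegral f ((-(2 * Real.pi)) • WithLp.ofLp w) := by
    rw [Real.fourier_eq', expIntegral, ← hofLp.integral_comp he]
    refine integral_congr_ae (.of_forall fun x => ?_)
    simp only [smul_dotProduct, EuclideanSpace.inner_eq_star_dotProduct, star_trivial, smul_eq_mul,
      Function.comp_apply]
    rw [mul_comm Complex.I, neg_mul, neg_mul]
  have hpi : (-(2 * Real.pi)) ≠ 0 := by simp [Real.pi_ne_zero]
  have hplancherel : ∫⁻ w, ‖expIntegral f ((-(2 * Real.pi)) • w)‖ₑ ^ 2 = ∫⁻ x, ‖f x‖ₑ ^ 2 := by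
    rw [← hofLp.lintegral_comp_emb he, ← hofLp.lintegral_comp_emb he]
    simp only [← hfourier]
    exact lintegral_enorm_fourier_sq (hofLp.integrable_comp_of_integrable hf₁)
      (hf₂.comp_measurePreserving hofLp)
  have hscale := (measurableEmbedding_const_smul₀ hpi).lintegral_map
    (μ := (volume : Measure (ι → ℝ))) fun u => ‖expIntegral f u‖ₑ ^ 2
  rw [Measure.map_addHaar_smul _ hpi, lintegral_smul_measure, hplancherel,
    Module.finrank_fintype_fun_eq_card, abs_inv, abs_pow, abs_neg, abs_of_pos Real.two_pi_pos,
    ENNReal.ofReal_inv_of_pos (pow_pos Real.two_pi_pos _)] at hscale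
  rw [← hscale, smul_eq_mul, ← mul_assoc, ENNReal.mul_inv_cancel, one_mul]
  · exact (ENNReal.ofReal_pos.2 (pow_pos Real.two_pi_pos _)).ne'
  · exact ENNReal.ofReal_ne_top

end Plancherel

section Weyl

variable {ι : Type} [Fintype ι]

theorem coeFn_weyl (ξ : Phase ι → ℝ) (ψ : L2 ι) : weyl ξ ψ =ᵐ[volume] weylFun ξ ψ :=
  MemLp.coeFn_toLp _

theorem weyl_eq_of_ae_eq {ξ : Phase ι → ℝ} {ψ φ : L2 ι} (h : φ =ᵐ[volume] weylFun ξ ψ) :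
    weyl ξ ψ = φ :=
  Lp.ext ((coeFn_weyl ξ ψ).trans h.symm)

theorem ae_comp_add_right {p : (ι → ℝ) → Prop} (h : ∀ᵐ x, p x) (v : ι → ℝ) :
    ∀ᵐ x : ι → ℝ, p (x + v) :=
  (measurePreserving_add_right volume v).quasiMeasurePreserving.ae h

theorem norm_weylFun (ξ : Phase ι → ℝ) (ψ : (ι → ℝ) → ℂ) (x : ι → ℝ) :
    ‖weylFun ξ ψ x‖ = ‖ψ (x + ξ ∘ Sum.inr)‖ := by
  rw [weylFun, norm_mul, mul_comm Complex.I, Complex.norm_exp_ofReal_mul_I, one_mul]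

theorem weyl_zero (ψ : L2 ι) : weyl 0 ψ = ψ := by
  refine weyl_eq_of_ae_eq (.of_forall fun x => ?_)
  simp [weylFun, Pi.zero_comp]

theorem norm_weyl (ξ : Phase ι → ℝ) (ψ : L2 ι) : ‖weyl ξ ψ‖ = ‖ψ‖ := by
  rw [weyl, Lp.norm_toLp, Lp.norm_def, ← eLpNorm_comp_measurePreserving
    (Lp.aestronglyMeasurable ψ) (measurePreserving_add_right volume (ξ ∘ Sum.inr))]
  exact congrArg _ (eLpNorm_congr_norm_ae (.of_forall (norm_weylFun ξ ψ)))

/-- The Weyl operator as a linear isometry. -/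
noncomputable def weylIsometry (ξ : Phase ι → ℝ) : L2 ι →ₗᵢ[ℂ] L2 ι where
  toFun := weyl ξ
  map_add' ψ φ := by
    refine weyl_eq_of_ae_eq ?_
    filter_upwards [Lp.coeFn_add (weyl ξ ψ) (weyl ξ φ), coeFn_weyl ξ ψ, coeFn_weyl ξ φ,
      ae_comp_add_right (Lp.coeFn_add ψ φ) (ξ ∘ Sum.inr)] with x hadd hψ hφ hshift
    rw [hadd, Pi.add_apply, hψ, hφ, weylFun, weylFun, weylFun, hshift, Pi.add_apply, mul_add]
  map_smul' c ψ := by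
    refine weyl_eq_of_ae_eq ?_
    filter_upwards [Lp.coeFn_smul c (weyl ξ ψ), coeFn_weyl ξ ψ,
      ae_comp_add_right (Lp.coeFn_smul c ψ) (ξ ∘ Sum.inr)] with x hsmul hψ hshift
    rw [RingHom.id_apply, hsmul, Pi.smul_apply, hψ, weylFun, weylFun, hshift, Pi.smul_apply,
      smul_eq_mul, smul_eq_mul, mul_left_comm]
  norm_map' := norm_weyl ξ

theorem weyl_smul (ξ : Phase ι → ℝ) (c : ℂ) (ψ : L2 ι) : weyl ξ (c • ψ) = c • weyl ξ ψ :=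
  (weylIsometry ξ).map_smul c ψ

variable [DecidableEq ι]

theorem dotProduct_J_mulVec (ξ η : Phase ι → ℝ) : ξ ⬝ᵥ J ι ℝ *ᵥ η =
    (η ∘ Sum.inl) ⬝ᵥ (ξ ∘ Sum.inr) - (ξ ∘ Sum.inl) ⬝ᵥ (η ∘ Sum.inr) := by
  rw [J, fromBlocks_mulVec, ← Sum.elim_comp_inl_inr ξ, sumElim_dotProduct_sumElim]
  simp [neg_mulVec, dotProduct_comm, sub_eq_neg_add]

theorem dotProduct_J_mulVec_self (ξ : Phase ι → ℝ) : ξ ⬝ᵥ J ι ℝ *ᵥ ξ = 0 := by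
  rw [dotProduct_J_mulVec, sub_self]

theorem weyl_weyl (ξ η : Phase ι → ℝ) (ψ : L2 ι) : weyl ξ (weyl η ψ) =
    Complex.exp (Complex.I * ((ξ ⬝ᵥ J ι ℝ *ᵥ η / 2 : ℝ) : ℂ)) • weyl (ξ + η) ψ := by
  refine weyl_eq_of_ae_eq ?_
  filter_upwards [Lp.coeFn_smul (Complex.exp (Complex.I * ((ξ ⬝ᵥ J ι ℝ *ᵥ η / 2 : ℝ) : ℂ)))
    (weyl (ξ + η) ψ), coeFn_weyl (ξ + η) ψ,
    ae_comp_add_right (coeFn_weyl η ψ) (ξ ∘ Sum.inr)] with x hsmul hadd hshift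
  rw [hsmul, Pi.smul_apply, hadd, weylFun, weylFun, hshift, weylFun, smul_eq_mul, ← mul_assoc,
    ← mul_assoc, ← Complex.exp_add, ← Complex.exp_add, Pi.add_comp, Pi.add_comp, add_assoc x,
    dotProduct_J_mulVec]
  congr 2
  simp only [dotProduct_add, add_dotProduct]
  push_cast
  ring

theorem inner_weyl_weyl (ξ η : Phase ι → ℝ) (ψ φ : L2 ι) : inner ℂ (weyl ξ ψ) (weyl η φ) =
    Complex.exp (-Complex.I * ((ξ ⬝ᵥ J ι ℝ *ᵥ η / 2 : ℝ) : ℂ)) *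
      inner ℂ ψ (weyl (η - ξ) φ) := by
  have hη : weyl η φ = Complex.exp (-Complex.I * ((ξ ⬝ᵥ J ι ℝ *ᵥ η / 2 : ℝ) : ℂ)) •
      weyl ξ (weyl (η - ξ) φ) := by
    rw [weyl_weyl, add_sub_cancel, smul_smul, ← Complex.exp_add, mulVec_sub, dotProduct_sub,
      dotProduct_J_mulVec_self, sub_zero, neg_mul, neg_add_cancel, Complex.exp_zero, one_smul]
  rw [hη, inner_smul_right]
  exact congrArg _ ((weylIsometry ξ).inner_map_map ψ _)

end Weyl

section Moments

open Filter Topology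

theorem exists_tendsto_of_tendsto_inner {𝕜 α H : Type*} [RCLike 𝕜] [NormedAddCommGroup H]
    [InnerProductSpace 𝕜 H] [CompleteSpace H] {l : Filter α} [l.NeBot] {D : α → H} {c : 𝕜}
    (h : Tendsto (fun p : α × α => inner 𝕜 (D p.1) (D p.2)) (l ×ˢ l) (𝓝 c)) :
    ∃ y, Tendsto D l (𝓝 y) := by
  have hcross := (RCLike.continuous_re.tendsto c).comp h
  have hdiag := hcross.comp (tendsto_id.prodMk tendsto_id)
  have hsq : Tendsto (fun p : α × α => ‖D p.1 - D p.2‖ ^ 2) (l ×ˢ l) (𝓝 0) := by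
    have hexpand := ((hdiag.comp tendsto_fst).sub (hcross.const_mul 2)).add
      (hdiag.comp (tendsto_snd (f := l) (g := l)))
    rw [show RCLike.re c - 2 * RCLike.re c + RCLike.re c = 0 by ring] at hexpand
    refine hexpand.congr fun p => ?_
    simp only [Function.comp_apply, id_eq, inner_self_eq_norm_sq, norm_sub_sq (𝕜 := 𝕜)]
  have hcauchy : Cauchy (map D l) := by
    rw [cauchy_map_iff', tendsto_uniformity_iff_dist_tendsto_zero]
    simpa only [Real.sqrt_sq (norm_nonneg _), Real.sqrt_zero, dist_eq_norm] using hsq.sqrt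
  exact CompleteSpace.complete hcauchy

/- With `a - 1 ~ a' s`, `b - 1 ~ b' t` and `g - 1 ~ g' s t`, the expression is
`s⁻¹ (a - 1) t⁻¹ (b - 1) + a b (s t)⁻¹ (g - 1)`. -/
theorem tendsto_mixed_difference_quotient {a b g : ℝ → ℂ} {a' b' g' : ℂ}
    (ha : HasDerivAt a a' 0) (hb : HasDerivAt b b' 0) (hg : HasDerivAt g g' 0)
    (ha₀ : a 0 = 1) (hb₀ : b 0 = 1) (hg₀ : g 0 = 1) :
    Tendsto (fun p : ℝ × ℝ => (p.1 : ℂ)⁻¹ * (p.2 : ℂ)⁻¹ *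
      (a p.1 * b p.2 * g (p.1 * p.2) - a p.1 - b p.2 + 1))
      (𝓝[≠] 0 ×ˢ 𝓝[≠] 0) (𝓝 (a' * b' + g')) := by
  have hslope {f : ℝ → ℂ} {f' : ℂ} (hf : HasDerivAt f f' 0) (hf₀ : f 0 = 1) :
      Tendsto (fun t : ℝ => (t : ℂ)⁻¹ * (f t - 1)) (𝓝[≠] 0) (𝓝 f') :=
    (hasDerivAt_iff_tendsto_slope.1 hf).congr fun t => by simp [slope_def_module, hf₀]
  have hone {f : ℝ → ℂ} {f' : ℂ} (hf : HasDerivAt f f' 0) (hf₀ : f 0 = 1) :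
      Tendsto f (𝓝[≠] 0) (𝓝 1) :=
    hf₀ ▸ hf.continuousAt.tendsto.mono_left nhdsWithin_le_nhds
  have hfst : Tendsto Prod.fst (𝓝[≠] (0 : ℝ) ×ˢ 𝓝[≠] (0 : ℝ)) (𝓝[≠] 0) := tendsto_fst
  have hsnd : Tendsto Prod.snd (𝓝[≠] (0 : ℝ) ×ˢ 𝓝[≠] (0 : ℝ)) (𝓝[≠] 0) := tendsto_snd
  have hmul : Tendsto (fun p : ℝ × ℝ => p.1 * p.2) (𝓝[≠] 0 ×ˢ 𝓝[≠] 0) (𝓝[≠] 0) := by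
    refine tendsto_nhdsWithin_iff.2 ⟨?_, ?_⟩
    · simpa using (hfst.mono_right nhdsWithin_le_nhds).mul (hsnd.mono_right nhdsWithin_le_nhds)
    · filter_upwards [hfst.eventually eventually_mem_nhdsWithin,
        hsnd.eventually eventually_mem_nhdsWithin] with p hs ht
      exact mul_ne_zero hs ht
  have hsum := (((hslope ha ha₀).comp hfst).mul ((hslope hb hb₀).comp hsnd)).add
    ((((hone ha ha₀).comp hfst).mul ((hone hb hb₀).comp hsnd)).mul ((hslope hg hg₀).comp hmul))
  rw [one_mul, one_mul] at hsum
  refine hsum.congr fun p => ?_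
  simp only [Function.comp_apply]
  push_cast
  rw [mul_inv]
  ring

theorem hasDerivAt_cexp_quadratic (b c : ℂ) :
    HasDerivAt (fun t : ℝ => Complex.exp (c * t + b * t ^ 2)) c 0 := by
  have hpoly : HasDerivAt (fun z : ℂ => c * z + b * z ^ 2) c ((0 : ℝ) : ℂ) := by
    simpa using ((hasDerivAt_id ((0 : ℝ) : ℂ)).const_mul c).fun_add
      (((hasDerivAt_id ((0 : ℝ) : ℂ)).pow 2).const_mul b)
  exact (by simpa using hpoly.cexp :
    HasDerivAt (fun z : ℂ => Complex.exp (c * z + b * z ^ 2)) c ((0 : ℝ) : ℂ)).comp_ofReal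

variable {ι : Type} [Fintype ι]

/-- The characteristic function of `φ` is Gaussian with covariance matrix `M` and mean `d`. -/
def HasGaussianChar (φ : L2 ι) (M : Matrix (Phase ι) (Phase ι) ℝ) (d : Phase ι → ℝ) : Prop :=
  M.IsSymm ∧ ∀ ξ : Phase ι → ℝ, inner ℂ φ (weyl ξ φ) =
    Complex.exp (Complex.I * ((ξ ⬝ᵥ d : ℝ) : ℂ) + ((-(ξ ⬝ᵥ M *ᵥ ξ) / 4 : ℝ) : ℂ))

variable {φ : L2 ι} {M : Matrix (Phase ι) (Phase ι) ℝ} {d : Phase ι → ℝ}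

theorem HasGaussianChar.norm_eq_one (h : HasGaussianChar φ M d) : ‖φ‖ = 1 := by
  have hzero := h.2 0
  rw [weyl_zero, inner_self_eq_norm_sq_to_K] at hzero
  have hsq : ‖φ‖ ^ 2 = 1 := by
    rw [← Complex.ofReal_inj]
    simpa using hzero
  exact (pow_eq_one_iff_of_nonneg (norm_nonneg _) two_ne_zero).1 hsq

theorem isPureGaussian_iff_exists_hasGaussianChar :
    IsPureGaussian φ ↔ ∃ V, HasGaussianChar φ V 0 := by
  have hmean (V : Matrix (Phase ι) (Phase ι) ℝ) (ξ : Phase ι → ℝ) :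
      Complex.I * ((ξ ⬝ᵥ (0 : Phase ι → ℝ) : ℝ) : ℂ) + ((-(ξ ⬝ᵥ V *ᵥ ξ) / 4 : ℝ) : ℂ) =
        ((-(ξ ⬝ᵥ V *ᵥ ξ) / 4 : ℝ) : ℂ) := by simp
  simp only [IsPureGaussian, HasGaussianChar, hmean]
  refine ⟨fun h => h.2, fun ⟨V, hV⟩ => ⟨?_, V, hV⟩⟩
  exact HasGaussianChar.norm_eq_one (d := 0) ⟨hV.1, by simpa only [hmean] using hV.2⟩

variable [DecidableEq ι]

theorem slope_orbit (k : Phase ι) (φ : L2 ι) (t : ℝ) :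
    slope (orbit k φ) 0 t = (t : ℂ)⁻¹ • (orbit k φ t - φ) := by
  rw [slope_def_module, sub_zero, ← Complex.ofReal_inv, Complex.coe_smul, orbit, orbit, zero_smul,
    weyl_zero]
  rfl

theorem HasGaussianChar.inner_orbit (h : HasGaussianChar φ M d) (k : Phase ι) (t : ℝ) :
    inner ℂ φ (orbit k φ t) =
      Complex.exp (Complex.I * d k * t + (-(M k k : ℂ) / 4) * t ^ 2) := by
  rw [orbit, h.2]
  congr 1
  simp only [mulVec_smul, smul_dotProduct, dotProduct_smul, single_one_dotProduct,
    mulVec_single_one, smul_eq_mul, col_apply]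
  push_cast
  ring

theorem HasGaussianChar.inner_orbit_left (h : HasGaussianChar φ M d) (k : Phase ι) (s : ℝ) :
    inner ℂ (orbit k φ s) φ =
      Complex.exp (-Complex.I * d k * s + (-(M k k : ℂ) / 4) * s ^ 2) := by
  rw [← inner_conj_symm, h.inner_orbit, ← Complex.exp_conj]
  simp [map_ofNat (starRingEnd ℂ) 4]

theorem HasGaussianChar.inner_orbit_orbit (h : HasGaussianChar φ M d) (k l : Phase ι) (s t : ℝ) :
    inner ℂ (orbit k φ s) (orbit l φ t) =
      Complex.exp (-Complex.I * d k * s + (-(M k k : ℂ) / 4) * s ^ 2) *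
      Complex.exp (Complex.I * d l * t + (-(M l l : ℂ) / 4) * t ^ 2) *
      Complex.exp ((M k l / 2 - Complex.I * J ι ℝ k l / 2) * ((s * t : ℝ) : ℂ) +
        0 * ((s * t : ℝ) : ℂ) ^ 2) := by
  rw [orbit, orbit, inner_weyl_weyl, h.2, ← Complex.exp_add, ← Complex.exp_add, ← Complex.exp_add]
  congr 1
  simp only [mulVec_smul, smul_dotProduct, dotProduct_smul, single_one_dotProduct, mulVec_sub,
    sub_dotProduct, dotProduct_sub, mulVec_single_one, smul_eq_mul, col_apply, h.1.apply]
  push_cast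
  ring

theorem HasGaussianChar.tendsto_inner_slope (h : HasGaussianChar φ M d) (k l : Phase ι) :
    Tendsto (fun p : ℝ × ℝ => inner ℂ (slope (orbit k φ) 0 p.1) (slope (orbit l φ) 0 p.2))
      (𝓝[≠] 0 ×ˢ 𝓝[≠] 0)
      (𝓝 (-Complex.I * d k * (Complex.I * d l) + (M k l / 2 - Complex.I * J ι ℝ k l / 2))) := by
  refine (tendsto_mixed_difference_quotient (hasDerivAt_cexp_quadratic (-(M k k : ℂ) / 4) _)
    (hasDerivAt_cexp_quadratic (-(M l l : ℂ) / 4) _) (hasDerivAt_cexp_quadratic 0 _)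
    (by simp) (by simp) (by simp)).congr fun p => ?_
  have hφ : inner ℂ φ φ = (1 : ℂ) := by
    rw [inner_self_eq_norm_sq_to_K, h.norm_eq_one]
    simp
  simp only [slope_orbit, inner_smul_left, inner_smul_right, inner_sub_left, inner_sub_right,
    h.inner_orbit, h.inner_orbit_left, h.inner_orbit_orbit, hφ, map_inv₀, Complex.conj_ofReal]
  ring

theorem HasGaussianChar.hasDerivAt_orbit (h : HasGaussianChar φ M d) (k : Phase ι) :
    HasDerivAt (orbit k φ) (deriv (orbit k φ) 0) 0 := by
  obtain ⟨y, hy⟩ := exists_tendsto_of_tendsto_inner (h.tendsto_inner_slope k k)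
  exact (hasDerivAt_iff_tendsto_slope.2 hy).differentiableAt.hasDerivAt

theorem HasGaussianChar.inner_quad_quad (h : HasGaussianChar φ M d) (k l : Phase ι) :
    inner ℂ (quad k φ) (quad l φ) =
      (d k * d l : ℂ) + (M k l / 2 - Complex.I * J ι ℝ k l / 2) := by
  have hslope (k : Phase ι) := hasDerivAt_iff_tendsto_slope.1 (h.hasDerivAt_orbit k)
  have hlim := tendsto_nhds_unique (((hslope k).comp tendsto_fst).inner
    ((hslope l).comp tendsto_snd)) (h.tendsto_inner_slope k l)
  rw [quad, quad, inner_smul_left, inner_smul_right, hlim, map_neg, Complex.conj_I]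
  linear_combination ((M k l / 2 - Complex.I * J ι ℝ k l / 2) * (-1 : ℂ) +
    d k * d l * (Complex.I ^ 2 - 1)) * Complex.I_sq

theorem HasGaussianChar.inner_quad (h : HasGaussianChar φ M d) (k : Phase ι) :
    inner ℂ φ (quad k φ) = (d k : ℂ) := by
  have hderiv := (hasDerivAt_const (0 : ℝ) φ).inner ℂ (h.hasDerivAt_orbit k)
  simp only [h.inner_orbit, inner_zero_left, add_zero] at hderiv
  rw [quad, inner_smul_right, hderiv.unique (hasDerivAt_cexp_quadratic _ _)]
  linear_combination -(d k : ℂ) * Complex.I_sq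

theorem HasGaussianChar.covMatrix_eq (h : HasGaussianChar φ M d) : covMatrix φ = M := by
  ext k l
  simp only [covMatrix, of_apply, h.inner_quad_quad, h.inner_quad]
  simp
  ring

theorem HasGaussianChar.norm_quad_sq (h : HasGaussianChar φ M d) (k : Phase ι) :
    ‖quad k φ‖ ^ 2 = M k k / 2 + d k ^ 2 := by
  have hJ : J ι ℝ k k = 0 := by
    have := dotProduct_J_mulVec_self (Pi.single k 1 : Phase ι → ℝ)
    rwa [mulVec_single_one, single_one_dotProduct] at this
  have hsq := h.inner_quad_quad k k
  rw [inner_self_eq_norm_sq_to_K, hJ] at hsq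
  have : ((‖quad k φ‖ ^ 2 : ℝ) : ℂ) = ((M k k / 2 + d k ^ 2 : ℝ) : ℂ) := by
    push_cast
    simpa [add_comm, sq] using hsq
  exact_mod_cast this

theorem HasGaussianChar.energy_eq (h : HasGaussianChar φ M d) :
    energy φ = ENNReal.ofReal (M.trace / 4 + (d ⬝ᵥ d) / 2) := by
  have hmoment (k : Phase ι) : secondMoment k φ = ENNReal.ofReal (M k k / 2 + d k ^ 2) := by
    rw [← h.norm_quad_sq]
    exact if_pos (h.hasDerivAt_orbit k).differentiableAt
  have hnonneg (k : Phase ι) : 0 ≤ M k k / 2 + d k ^ 2 := h.norm_quad_sq k ▸ sq_nonneg _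
  rw [energy, Finset.sum_congr rfl fun k _ => hmoment k,
    ← ENNReal.ofReal_sum_of_nonneg fun k _ => hnonneg k, ← ENNReal.ofReal_ofNat 2,
    ← ENNReal.ofReal_div_of_pos two_pos]
  congr 1
  simp only [Finset.sum_add_distrib, trace, dotProduct, ← Finset.sum_div, diag_apply, sq]
  ring

theorem HasGaussianChar.inner_sum_quad_sub (h : HasGaussianChar φ M d) (x y : Phase ι → ℝ) :
    inner ℂ (∑ k, (x k : ℂ) • (quad k φ - (d k : ℂ) • φ))
      (∑ l, (y l : ℂ) • (quad l φ - (d l : ℂ) • φ)) =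
      ((x ⬝ᵥ M *ᵥ y : ℝ) : ℂ) / 2 - Complex.I * ((x ⬝ᵥ J ι ℝ *ᵥ y : ℝ) : ℂ) / 2 := by
  have hcentered (k l : Phase ι) : inner ℂ (quad k φ - (d k : ℂ) • φ) (quad l φ - (d l : ℂ) • φ) =
      (M k l : ℂ) / 2 - Complex.I * J ι ℝ k l / 2 := by
    have hleft : inner ℂ (quad k φ) φ = (d k : ℂ) := by
      rw [← inner_conj_symm, h.inner_quad, Complex.conj_ofReal]
    simp only [inner_sub_left, inner_sub_right, inner_smul_left, inner_smul_right,
      h.inner_quad_quad, h.inner_quad, hleft, inner_self_eq_norm_sq_to_K, h.norm_eq_one,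
      Complex.conj_ofReal, RCLike.ofReal_one]
    ring
  simp only [sum_inner, inner_sum, inner_smul_left, inner_smul_right, hcentered,
    Complex.conj_ofReal, dotProduct, mulVec, Finset.mul_sum, Finset.sum_div,
    ← Finset.sum_sub_distrib, Complex.ofReal_sum]
  rw [Finset.sum_comm]
  refine Finset.sum_congr rfl fun k _ => Finset.sum_congr rfl fun l _ => ?_
  push_cast
  ring

theorem HasGaussianChar.uncertainty (h : HasGaussianChar φ M d) : Uncertainty M := by
  intro x y
  let Q (x : Phase ι → ℝ) : L2 ι := ∑ k, (x k : ℂ) • (quad k φ - (d k : ℂ) • φ)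
  have hnorm (x : Phase ι → ℝ) : ‖Q x‖ ^ 2 = x ⬝ᵥ M *ᵥ x / 2 := by
    have hre := congrArg Complex.re (h.inner_sum_quad_sub x x)
    rw [dotProduct_J_mulVec_self] at hre
    simpa [Q, ← inner_self_eq_norm_sq (𝕜 := ℂ)] using hre
  have him : (inner ℂ (Q x) (Q y)).im = -(x ⬝ᵥ J ι ℝ *ᵥ y) / 2 := by
    rw [h.inner_sum_quad_sub x y]
    simp [neg_div]
  have hcs : -(inner ℂ (Q x) (Q y)).im ≤ ‖Q x‖ * ‖Q y‖ :=
    (neg_le_abs _).trans ((Complex.abs_im_le_norm _).trans (norm_inner_le_norm _ _))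
  nlinarith [sq_nonneg (‖Q x‖ - ‖Q y‖), hnorm x, hnorm y, hcs, him]

end Moments

section GaussianIntegral

variable {ι : Type} [Fintype ι]

theorem integral_exp_neg_mul_dotProduct_self (c : ℝ) :
    ∫ x : ι → ℝ, Real.exp (-c * (x ⬝ᵥ x)) = √(Real.pi / c) ^ Fintype.card ι := by
  rw [← integral_gaussian, ← integral_fintype_prod_volume_eq_pow]
  simp only [← Real.exp_sum, ← Finset.mul_sum, dotProduct, sq]

variable [DecidableEq ι] {L : Matrix ι ι ℝ}

theorem measurableEmbedding_mulVec (hL : IsUnit L.det) :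
    MeasurableEmbedding fun x : ι → ℝ => L *ᵥ x :=
  (Continuous.matrix_mulVec continuous_const continuous_id).measurableEmbedding
    (mulVec_injective_of_det_ne_zero hL.ne_zero)

theorem map_mulVec_volume (hL : IsUnit L.det) :
    Measure.map (fun x : ι → ℝ => L *ᵥ x) volume = ENNReal.ofReal |L.det|⁻¹ • volume := by
  rw [← abs_inv]
  exact Real.map_matrix_volume_pi_eq_smul_volume_pi hL.ne_zero

theorem integral_comp_mulVec {E : Type*} [NormedAddCommGroup E] [NormedSpace ℝ E]
    (hL : IsUnit L.det) (f : (ι → ℝ) → E) : ∫ x, f (L *ᵥ x) = |L.det|⁻¹ • ∫ x, f x := by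
  rw [← (measurableEmbedding_mulVec hL).integral_map, map_mulVec_volume hL, integral_smul_measure,
    ENNReal.toReal_ofReal (inv_nonneg.2 (abs_nonneg _))]

theorem integral_exp_neg_mul_quadratic (c : ℝ) {N : Matrix ι ι ℝ} (hN : N.PosDef) :
    ∫ x : ι → ℝ, Real.exp (-c * (x ⬝ᵥ N *ᵥ x)) = √(Real.pi / c) ^ Fintype.card ι / √N.det := by
  obtain ⟨B, hB, rfl⟩ := exists_isUnit_det_eq_transpose_mul_self hN
  have hquad (x : ι → ℝ) : x ⬝ᵥ (Bᵀ * B) *ᵥ x = (B *ᵥ x) ⬝ᵥ (B *ᵥ x) := by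
    rw [← mulVec_mulVec, dotProduct_mulVec, vecMul_transpose]
  simp only [hquad]
  rw [integral_comp_mulVec hB fun y => Real.exp (-c * (y ⬝ᵥ y)),
    integral_exp_neg_mul_dotProduct_self, det_mul, det_transpose, Real.sqrt_mul_self_eq_abs,
    smul_eq_mul, mul_comm, div_eq_mul_inv (_ ^ _)]

end GaussianIntegral

section Splitting

variable {ι κ : Type} [Fintype ι] [Fintype κ]

theorem measurePreserving_sumElim :
    MeasurePreserving fun p : (ι → ℝ) × (κ → ℝ) => (Sum.elim p.1 p.2 : ι ⊕ κ → ℝ) := by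
  convert! volume_measurePreserving_sumPiEquivProdPi_symm fun _ : ι ⊕ κ => ℝ using 1

theorem measurePreserving_comp_inl_comp_inr :
    MeasurePreserving fun z : ι ⊕ κ → ℝ => (z ∘ Sum.inl, z ∘ Sum.inr) :=
  volume_measurePreserving_sumPiEquivProdPi fun _ => ℝ

theorem ae_comp_inl {p : (ι → ℝ) → Prop} (h : ∀ᵐ x, p x) :
    ∀ᵐ z : ι ⊕ κ → ℝ, p (z ∘ Sum.inl) :=
  (Measure.quasiMeasurePreserving_fst.comp
    measurePreserving_comp_inl_comp_inr.quasiMeasurePreserving).ae h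

theorem ae_comp_inr {p : (κ → ℝ) → Prop} (h : ∀ᵐ y, p y) :
    ∀ᵐ z : ι ⊕ κ → ℝ, p (z ∘ Sum.inr) :=
  (Measure.quasiMeasurePreserving_snd.comp
    measurePreserving_comp_inl_comp_inr.quasiMeasurePreserving).ae h

theorem integrable_comp_sumElim {E : Type*} [NormedAddCommGroup E] {f : (ι ⊕ κ → ℝ) → E}
    (hf : Integrable f) : Integrable fun p : (ι → ℝ) × (κ → ℝ) => f (Sum.elim p.1 p.2) :=
  measurePreserving_sumElim.integrable_comp_of_integrable hf

theorem lintegral_eq_lintegral_sumElim {f : (ι ⊕ κ → ℝ) → ℝ≥0∞} (hf : Measurable f) :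
    ∫⁻ z, f z = ∫⁻ x : ι → ℝ, ∫⁻ y : κ → ℝ, f (Sum.elim x y) := by
  rw [← measurePreserving_sumElim.lintegral_comp hf]
  exact lintegral_prod _ (hf.comp measurePreserving_sumElim.measurable).aemeasurable

theorem integral_eq_integral_sumElim {E : Type*} [NormedAddCommGroup E] [NormedSpace ℝ E]
    {f : (ι ⊕ κ → ℝ) → E} (hf : Integrable f) :
    ∫ z, f z = ∫ x : ι → ℝ, ∫ y : κ → ℝ, f (Sum.elim x y) := by
  have hemb := (MeasurableEquiv.sumPiEquivProdPi fun _ : ι ⊕ κ => ℝ).measurableEmbedding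
  have hf' := integrable_comp_sumElim hf
  rw [← integral_prod _ hf', ← Measure.volume_eq_prod,
    ← measurePreserving_comp_inl_comp_inr.integral_comp hemb]
  simp only [Sum.elim_comp_inl_inr]

end Splitting

section Kernels

variable {ι : Type} [Fintype ι]

/-- The characteristic function `ξ ↦ Tr (K e^{i ξ·R})` of an operator with integral kernel `K`. -/
noncomputable def kernelChar (K : (ι → ℝ) → (ι → ℝ) → ℂ) (ξ : Phase ι → ℝ) : ℂ :=
  ∫ x, Complex.exp (Complex.I *
      (((ξ ∘ Sum.inl) ⬝ᵥ x + (ξ ∘ Sum.inl) ⬝ᵥ (ξ ∘ Sum.inr) / 2 : ℝ) : ℂ)) *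
    K (x + ξ ∘ Sum.inr) x

/-- Square-integrable kernels whose shifted diagonals are all integrable, so that `kernelChar` is
defined everywhere by an absolutely convergent integral. -/
structure IsTraceKernel (K : (ι → ℝ) → (ι → ℝ) → ℂ) : Prop where
  measurable : Measurable (Function.uncurry K)
  integrable_shift (v : ι → ℝ) : Integrable fun x => K (x + v) x
  memLp : MemLp (Function.uncurry K) 2

theorem integrable_exp_mul (a : ℝ) (u : ι → ℝ) {f : (ι → ℝ) → ℂ} (hf : Integrable f) :
    Integrable fun x => Complex.exp (Complex.I * ((u ⬝ᵥ x + a : ℝ) : ℂ)) * f x := by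
  have hcont : Continuous fun x : ι → ℝ => Complex.exp (Complex.I * ((u ⬝ᵥ x + a : ℝ) : ℂ)) := by
    have := Continuous.dotProduct (continuous_const (y := u)) (continuous_id (X := ι → ℝ))
    fun_prop
  refine hf.bdd_mul (c := 1) hcont.aestronglyMeasurable (.of_forall fun x => ?_)
  rw [mul_comm, Complex.norm_exp_ofReal_mul_I]

variable {K K' : (ι → ℝ) → (ι → ℝ) → ℂ}

theorem IsTraceKernel.sub (hK : IsTraceKernel K) (hK' : IsTraceKernel K') :
    IsTraceKernel (K - K') where
  measurable := hK.measurable.sub hK'.measurable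
  integrable_shift v := (hK.integrable_shift v).sub (hK'.integrable_shift v)
  memLp := hK.memLp.sub hK'.memLp

theorem IsTraceKernel.kernelChar_sub (hK : IsTraceKernel K) (hK' : IsTraceKernel K')
    (ξ : Phase ι → ℝ) : kernelChar (K - K') ξ = kernelChar K ξ - kernelChar K' ξ := by
  rw [kernelChar, kernelChar, kernelChar, ← integral_sub
    (integrable_exp_mul _ _ (hK.integrable_shift _))
    (integrable_exp_mul _ _ (hK'.integrable_shift _))]
  simp only [Pi.sub_apply, mul_sub]

theorem enorm_kernelChar (K : (ι → ℝ) → (ι → ℝ) → ℂ) (u v : ι → ℝ) :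
    ‖kernelChar K (Sum.elim u v)‖ₑ = ‖expIntegral (fun x => K (x + v) x) u‖ₑ := by
  have hphase : kernelChar K (Sum.elim u v) =
      Complex.exp (((u ⬝ᵥ v / 2 : ℝ) : ℂ) * Complex.I) *
        expIntegral (fun x => K (x + v) x) u := by
    rw [expIntegral, ← integral_const_mul, kernelChar, Sum.elim_comp_inl, Sum.elim_comp_inr]
    refine integral_congr_ae (.of_forall fun x => ?_)
    simp only [← mul_assoc, ← Complex.exp_add]
    congr 2
    push_cast
    ring
  rw [hphase, enorm_mul, ← ofReal_norm, Complex.norm_exp_ofReal_mul_I, ENNReal.ofReal_one, one_mul]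

theorem measurable_kernelChar (hK : Measurable (Function.uncurry K)) :
    Measurable (kernelChar K) := by
  have hcont : Continuous fun p : (Phase ι → ℝ) × (ι → ℝ) => Complex.exp (Complex.I *
      (((p.1 ∘ Sum.inl) ⬝ᵥ p.2 + (p.1 ∘ Sum.inl) ⬝ᵥ (p.1 ∘ Sum.inr) / 2 : ℝ) : ℂ)) := by
    simp only [dotProduct, Function.comp_apply]
    fun_prop
  have hshift : Measurable fun p : (Phase ι → ℝ) × (ι → ℝ) => (p.2 + p.1 ∘ Sum.inr, p.2) := by
    have : Continuous fun p : (Phase ι → ℝ) × (ι → ℝ) => p.1 ∘ Sum.inr :=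
      (Pi.continuous_precomp Sum.inr).comp continuous_fst
    fun_prop
  exact (hcont.measurable.mul (hK.comp hshift)).stronglyMeasurable.integral_prod_right'.measurable

theorem lintegral_lintegral_shift {f : (ι → ℝ) × (ι → ℝ) → ℝ≥0∞} (hf : Measurable f) :
    ∫⁻ v, ∫⁻ x, f (x + v, x) = ∫⁻ p, f p := by
  have hshift : Measurable fun p : (ι → ℝ) × (ι → ℝ) => f (p.2 + p.1, p.2) :=
    hf.comp ((measurable_snd.add measurable_fst).prodMk measurable_snd)
  calc ∫⁻ v, ∫⁻ x, f (x + v, x) = ∫⁻ x, ∫⁻ v, f (x + v, x) :=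
        lintegral_lintegral_swap hshift.aemeasurable
    _ = ∫⁻ x, ∫⁻ y, f (y, x) :=
        lintegral_congr fun x => lintegral_add_left_eq_self (fun y => f (y, x)) x
    _ = ∫⁻ p, f p := (lintegral_prod_symm' f hf).symm

theorem IsTraceKernel.measurable_enorm_sq (hK : IsTraceKernel K) :
    Measurable fun p : (ι → ℝ) × (ι → ℝ) => ‖K p.1 p.2‖ₑ ^ 2 :=
  hK.measurable.enorm.pow_const 2

theorem IsTraceKernel.ae_memLp_shift (hK : IsTraceKernel K) :
    ∀ᵐ v, MemLp (fun x => K (x + v) x) 2 := by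
  have hshift : Measurable fun p : (ι → ℝ) × (ι → ℝ) => (p.2 + p.1, p.2) :=
    (measurable_snd.add measurable_fst).prodMk measurable_snd
  have hfin : ∫⁻ v, ∫⁻ x, ‖K (x + v) x‖ₑ ^ 2 ≠ ⊤ := by
    rw [lintegral_lintegral_shift hK.measurable_enorm_sq]
    exact (lintegral_enorm_sq_eq _).trans_ne (ENNReal.pow_ne_top hK.memLp.2.ne)
  filter_upwards [ae_lt_top (hK.measurable_enorm_sq.comp hshift).lintegral_prod_right' hfin]
    with v hv
  refine ⟨(hK.integrable_shift v).1, ?_⟩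
  simp only [Function.comp_apply, lintegral_enorm_sq_eq] at hv
  exact (ENNReal.pow_lt_top_iff.1 hv).resolve_right two_ne_zero

/- For fixed `v`, the characteristic function is up to a phase the Fourier transform of the shifted
diagonal `x ↦ K (x + v) x`, so Plancherel applies slice by slice. -/
theorem IsTraceKernel.lintegral_enorm_kernelChar_sq (hK : IsTraceKernel K) :
    ∫⁻ ξ, ‖kernelChar K ξ‖ₑ ^ 2 =
      ENNReal.ofReal ((2 * Real.pi) ^ Fintype.card ι) *
        ∫⁻ p : (ι → ℝ) × (ι → ℝ), ‖K p.1 p.2‖ₑ ^ 2 := by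
  have hmeas := (measurable_kernelChar hK.measurable).enorm.pow_const 2
  rw [lintegral_eq_lintegral_sumElim hmeas,
    lintegral_lintegral_swap (f := fun u v => ‖kernelChar K (Sum.elim u v)‖ₑ ^ 2)
      (hmeas.comp measurePreserving_sumElim.measurable).aemeasurable,
    ← lintegral_lintegral_shift hK.measurable_enorm_sq,
    ← lintegral_const_mul' _ _ ENNReal.ofReal_ne_top]
  refine lintegral_congr_ae ?_
  filter_upwards [hK.ae_memLp_shift] with v hv
  simp only [enorm_kernelChar]
  exact lintegral_enorm_expIntegral_sq (hK.integrable_shift v) hv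

theorem IsTraceKernel.ae_eq_zero_of_kernelChar_eq_zero (hK : IsTraceKernel K)
    (h : ∀ ξ, kernelChar K ξ = 0) : ∀ᵐ x, ∀ᵐ y, K x y = 0 := by
  have hzero := hK.lintegral_enorm_kernelChar_sq
  simp only [h, enorm_zero, ne_eq, OfNat.ofNat_ne_zero, not_false_eq_true, zero_pow,
    lintegral_zero] at hzero
  have hpi : ENNReal.ofReal ((2 * Real.pi) ^ Fintype.card ι) ≠ 0 :=
    (ENNReal.ofReal_pos.2 (pow_pos Real.two_pi_pos _)).ne'
  have hae := (lintegral_eq_zero_iff hK.measurable_enorm_sq).1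
    ((mul_eq_zero.1 hzero.symm).resolve_left hpi)
  filter_upwards [Measure.ae_ae_of_ae_prod hae] with x hx
  filter_upwards [hx] with y hy
  simpa using hy

variable [DecidableEq ι]

theorem lintegral_exp_neg_quadratic {M : Matrix (Phase ι) (Phase ι) ℝ} (hM : M.PosDef) :
    ∫⁻ ξ : Phase ι → ℝ, ENNReal.ofReal (Real.exp (-(1 / 2) * (ξ ⬝ᵥ M *ᵥ ξ))) =
      ENNReal.ofReal ((2 * Real.pi) ^ Fintype.card ι * (√M.det)⁻¹) := by
  have hint := integral_exp_neg_mul_quadratic (1 / 2) hM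
  have hcard : √(Real.pi / (1 / 2)) ^ Fintype.card (Phase ι) =
      (2 * Real.pi) ^ Fintype.card ι := by
    rw [Fintype.card_sum, ← two_mul, pow_mul, Real.sq_sqrt (by positivity)]
    ring_nf
  rw [hcard] at hint
  have hpos := Real.sqrt_pos.2 hM.det_pos
  rw [← div_eq_mul_inv, ← hint,
    ofReal_integral_eq_lintegral_ofReal (.of_integral_ne_zero (by rw [hint]; positivity))
      (.of_forall fun _ => (Real.exp_pos _).le)]

theorem IsTraceKernel.integral_norm_sq_eq (hK : IsTraceKernel K)
    {M : Matrix (Phase ι) (Phase ι) ℝ} (hM : M.PosDef)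
    (h : ∀ ξ, ‖kernelChar K ξ‖ = Real.exp (-(ξ ⬝ᵥ M *ᵥ ξ) / 4)) :
    ∫ x, ∫ y, ‖K x y‖ ^ 2 = (√M.det)⁻¹ := by
  have hchar (ξ : Phase ι → ℝ) : ‖kernelChar K ξ‖ₑ ^ 2 =
      ENNReal.ofReal (Real.exp (-(1 / 2) * (ξ ⬝ᵥ M *ᵥ ξ))) := by
    rw [← ofReal_norm, h, ← ENNReal.ofReal_pow (Real.exp_pos _).le, ← Real.exp_nat_mul]
    congr 2
    push_cast
    ring
  have hlint := hK.lintegral_enorm_kernelChar_sq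
  simp only [hchar] at hlint
  rw [lintegral_exp_neg_quadratic hM, ENNReal.ofReal_mul (by positivity),
    ENNReal.mul_right_inj (ENNReal.ofReal_pos.2 (pow_pos Real.two_pi_pos _)).ne'
      ENNReal.ofReal_ne_top] at hlint
  have hsq : Integrable fun p : (ι → ℝ) × (ι → ℝ) => ‖K p.1 p.2‖ ^ 2 :=
    hK.memLp.integrable_norm_pow two_ne_zero
  rw [integral_integral hsq, ← Measure.volume_eq_prod, integral_eq_lintegral_of_nonneg_ae
    (.of_forall fun _ => sq_nonneg _) hsq.1]
  simp only [ENNReal.ofReal_pow (norm_nonneg _), ofReal_norm]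
  rw [← hlint]
  exact ENNReal.toReal_ofReal (by positivity)

end Kernels

section KetBra

theorem memLp_two_mul_prod {α β 𝕜 : Type*} [RCLike 𝕜] [MeasurableSpace α] [MeasurableSpace β]
    {μ : Measure α} {ν : Measure β} [SFinite μ] [SFinite ν] {f : α → 𝕜} {g : β → 𝕜}
    (hf : MemLp f 2 μ) (hg : MemLp g 2 ν) : MemLp (fun p => f p.1 * g p.2) 2 (μ.prod ν) := by
  rw [memLp_two_iff_integrable_sq_norm (f := fun p : α × β => f p.1 * g p.2)
    (hf.1.comp_fst.mul hg.1.comp_snd)]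
  simpa only [norm_mul, mul_pow] using
    (hf.integrable_norm_pow two_ne_zero).mul_prod (hg.integrable_norm_pow two_ne_zero)

variable {ι : Type} [Fintype ι]

theorem norm_sq_eq_integral (φ : L2 ι) : ‖φ‖ ^ 2 = ∫ x, ‖φ x‖ ^ 2 := by
  rw [← inner_self_eq_norm_sq (𝕜 := ℂ), L2.inner_def, ← integral_re (L2.integrable_inner φ φ)]
  simp only [inner_self_eq_norm_sq]

/-- The integral kernel `g(x) conj f(y)` of the rank-one operator `|g⟩⟨f|`. -/
noncomputable def ketBra (g f : L2 ι) (x y : ι → ℝ) : ℂ :=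
  g x * (starRingEnd ℂ) (f y)

theorem isTraceKernel_ketBra (g f : L2 ι) : IsTraceKernel (ketBra g f) where
  measurable := ((Lp.stronglyMeasurable g).measurable.comp measurable_fst).mul
    (Complex.continuous_conj.measurable.comp
      ((Lp.stronglyMeasurable f).measurable.comp measurable_snd))
  integrable_shift v := ((Lp.memLp g).comp_measurePreserving
    (measurePreserving_add_right volume v)).integrable_mul (Lp.memLp f).star
  memLp := memLp_two_mul_prod (Lp.memLp g) (Lp.memLp f).star

theorem kernelChar_ketBra (g f : L2 ι) (ξ : Phase ι → ℝ) :
    kernelChar (ketBra g f) ξ = inner ℂ f (weyl ξ g) := by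
  rw [L2.inner_def]
  refine integral_congr_ae ?_
  filter_upwards [coeFn_weyl ξ g] with x hx
  rw [hx, RCLike.inner_apply, weylFun, ketBra, mul_assoc]

theorem inner_smul_eq_of_inner_weyl_eq {f f' g g' : L2 ι}
    (h : ∀ ξ, inner ℂ f (weyl ξ g) = inner ℂ f' (weyl ξ g')) (φ : L2 ι) :
    inner ℂ f φ • g = inner ℂ f' φ • g' := by
  have hK := isTraceKernel_ketBra g f
  have hK' := isTraceKernel_ketBra g' f'
  have hae := (hK.sub hK').ae_eq_zero_of_kernelChar_eq_zero fun ξ => by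
    rw [hK.kernelChar_sub hK', kernelChar_ketBra, kernelChar_ketBra, h, sub_self]
  apply Lp.ext
  filter_upwards [hae, Lp.coeFn_smul (inner ℂ f φ) g, Lp.coeFn_smul (inner ℂ f' φ) g']
    with x hx hg hg'
  rw [hg, hg', Pi.smul_apply, Pi.smul_apply, smul_eq_mul, smul_eq_mul, L2.inner_def, L2.inner_def,
    ← integral_mul_const, ← integral_mul_const]
  simp only [RCLike.inner_apply]
  refine integral_congr_ae ?_
  filter_upwards [hx] with y hy
  rw [Pi.sub_apply, Pi.sub_apply, ketBra, ketBra] at hy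
  linear_combination φ y * hy

theorem eq_smul_of_inner_weyl_eq {φ ψ : L2 ι} (hφ : ‖φ‖ = 1)
    (h : ∀ ξ, inner ℂ φ (weyl ξ φ) = inner ℂ ψ (weyl ξ ψ)) : φ = (inner ℂ ψ φ : ℂ) • ψ := by
  rw [← inner_smul_eq_of_inner_weyl_eq h, inner_self_eq_norm_sq_to_K, hφ]
  simp

theorem topologicalClosure_span_weyl {g : L2 ι} (hg : g ≠ 0) :
    (Submodule.span ℂ (Set.range fun ξ => weyl ξ g)).topologicalClosure = ⊤ := by
  rw [Submodule.topologicalClosure_eq_top_iff, Submodule.eq_bot_iff]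
  intro f hf
  have horth (ξ : Phase ι → ℝ) : inner ℂ f (weyl ξ g) = inner ℂ (0 : L2 ι) (weyl ξ g) := by
    rw [inner_zero_left]
    exact Submodule.inner_left_of_mem_orthogonal
      (Submodule.subset_span (Set.mem_range_self ξ)) hf
  have hzero := inner_smul_eq_of_inner_weyl_eq horth f
  rw [inner_zero_left, zero_smul, smul_eq_zero, inner_self_eq_zero] at hzero
  exact hzero.resolve_right hg

theorem HasGaussianChar.norm_inner_weyl {φ : L2 ι} {V : Matrix (Phase ι) (Phase ι) ℝ}
    {d : Phase ι → ℝ} (h : HasGaussianChar φ V d) (ξ : Phase ι → ℝ) :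
    ‖(inner ℂ φ (weyl ξ φ) : ℂ)‖ = Real.exp (-(ξ ⬝ᵥ V *ᵥ ξ) / 4) := by
  rw [h.2, Complex.norm_exp]
  simp

variable [DecidableEq ι]

theorem HasGaussianChar.det_eq_one {φ : L2 ι} {V : Matrix (Phase ι) (Phase ι) ℝ}
    {d : Phase ι → ℝ} (h : HasGaussianChar φ V d) : V.det = 1 := by
  have hpos := h.uncertainty.posDef h.1
  have hpurity := (isTraceKernel_ketBra φ φ).integral_norm_sq_eq hpos fun ξ => by
    rw [kernelChar_ketBra, h.norm_inner_weyl]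
  have hnorm : ∫ x, ‖φ x‖ ^ 2 = 1 := by
    rw [← norm_sq_eq_integral, h.norm_eq_one, one_pow]
  simp only [ketBra, norm_mul, RCLike.norm_conj, mul_pow, integral_const_mul, hnorm,
    mul_one] at hpurity
  rwa [eq_comm, inv_eq_one, Real.sqrt_eq_one] at hpurity

end KetBra

section ReducedKernel

theorem sumElim_add_sumElim_zero {ι κ : Type*} (x v : ι → ℝ) (y : κ → ℝ) :
    Sum.elim x y + Sum.elim v 0 = Sum.elim (x + v) y := by
  rw [← Sum.elim_add_add, add_zero]

theorem enorm_integral_mul_sq_le {α 𝕜 : Type*} [RCLike 𝕜] [MeasurableSpace α] {μ : Measure α}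
    {f g : α → 𝕜} (hf : AEStronglyMeasurable f μ) (hg : AEStronglyMeasurable g μ) :
    ‖∫ x, f x * g x ∂μ‖ₑ ^ 2 ≤ (∫⁻ x, ‖f x‖ₑ ^ 2 ∂μ) * ∫⁻ x, ‖g x‖ₑ ^ 2 ∂μ := by
  rw [lintegral_enorm_sq_eq, lintegral_enorm_sq_eq, ← mul_pow]
  gcongr
  calc ‖∫ x, f x * g x ∂μ‖ₑ ≤ eLpNorm (f • g) 1 μ :=
        (enorm_integral_le_lintegral_enorm _).trans_eq eLpNorm_one_eq_lintegral_enorm.symm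
    _ ≤ eLpNorm f 2 μ * eLpNorm g 2 μ := eLpNorm_smul_le_mul_eLpNorm hg hf

variable {ι κ : Type} [Fintype ι] [Fintype κ] (ψ : L2 (ι ⊕ κ))

theorem measurable_comp_sumElim :
    Measurable fun p : (ι → ℝ) × (κ → ℝ) => ψ (Sum.elim p.1 p.2) :=
  (Lp.stronglyMeasurable ψ).measurable.comp measurePreserving_sumElim.measurable

theorem measurable_reducedKernel : Measurable (Function.uncurry (reducedKernel ψ)) := by
  have hleft : Measurable fun q : ((ι → ℝ) × (ι → ℝ)) × (κ → ℝ) => ψ (Sum.elim q.1.1 q.2) :=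
    (measurable_comp_sumElim ψ).comp (measurable_fst.fst.prodMk measurable_snd)
  have hright : Measurable fun q : ((ι → ℝ) × (ι → ℝ)) × (κ → ℝ) => ψ (Sum.elim q.1.2 q.2) :=
    (measurable_comp_sumElim ψ).comp (measurable_fst.snd.prodMk measurable_snd)
  exact (hleft.mul (Complex.continuous_conj.measurable.comp
    hright)).stronglyMeasurable.integral_prod_right'.measurable

theorem enorm_reducedKernel_sq_le (x x' : ι → ℝ) :
    ‖reducedKernel ψ x x'‖ₑ ^ 2 ≤
      (∫⁻ y : κ → ℝ, ‖ψ (Sum.elim x y)‖ₑ ^ 2) * ∫⁻ y : κ → ℝ, ‖ψ (Sum.elim x' y)‖ₑ ^ 2 := by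
  have hmeas (x : ι → ℝ) : Measurable fun y : κ → ℝ => ψ (Sum.elim x y) :=
    (measurable_comp_sumElim ψ).comp measurable_prodMk_left
  have hconj := Complex.continuous_conj.measurable.comp (hmeas x')
  simpa only [reducedKernel, Function.comp_apply, RCLike.enorm_conj] using enorm_integral_mul_sq_le
    (hmeas x).aestronglyMeasurable hconj.aestronglyMeasurable

theorem memLp_reducedKernel : MemLp (Function.uncurry (reducedKernel ψ)) 2 := by
  refine ⟨(measurable_reducedKernel ψ).aestronglyMeasurable, ?_⟩
  have hslice : Measurable fun x : ι → ℝ => ∫⁻ y : κ → ℝ, ‖ψ (Sum.elim x y)‖ₑ ^ 2 :=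
    ((measurable_comp_sumElim ψ).enorm.pow_const 2).lintegral_prod_right'
  have hfin : ∫⁻ x : ι → ℝ, ∫⁻ y : κ → ℝ, ‖ψ (Sum.elim x y)‖ₑ ^ 2 < ⊤ := by
    rw [← lintegral_eq_lintegral_sumElim ((Lp.stronglyMeasurable ψ).measurable.enorm.pow_const 2),
      lintegral_enorm_sq_eq]
    exact ENNReal.pow_lt_top (Lp.memLp ψ).2
  refine (ENNReal.pow_lt_top_iff.1 ?_).resolve_right two_ne_zero
  rw [← lintegral_enorm_sq_eq]
  calc ∫⁻ p, ‖Function.uncurry (reducedKernel ψ) p‖ₑ ^ 2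
      ≤ ∫⁻ p : (ι → ℝ) × (ι → ℝ), (∫⁻ y : κ → ℝ, ‖ψ (Sum.elim p.1 y)‖ₑ ^ 2) *
          ∫⁻ y : κ → ℝ, ‖ψ (Sum.elim p.2 y)‖ₑ ^ 2 :=
        lintegral_mono fun p => enorm_reducedKernel_sq_le ψ p.1 p.2
    _ = (∫⁻ x : ι → ℝ, ∫⁻ y : κ → ℝ, ‖ψ (Sum.elim x y)‖ₑ ^ 2) *
          ∫⁻ x : ι → ℝ, ∫⁻ y : κ → ℝ, ‖ψ (Sum.elim x y)‖ₑ ^ 2 :=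
        lintegral_prod_mul hslice.aemeasurable hslice.aemeasurable
    _ < ⊤ := ENNReal.mul_lt_top hfin hfin

theorem integrable_ketBra_shift_left (v : ι → ℝ) :
    Integrable fun p : (ι → ℝ) × (κ → ℝ) =>
      ψ (Sum.elim (p.1 + v) p.2) * (starRingEnd ℂ) (ψ (Sum.elim p.1 p.2)) := by
  simpa only [ketBra, sumElim_add_sumElim_zero] using integrable_comp_sumElim
    ((isTraceKernel_ketBra ψ ψ).integrable_shift (Sum.elim v 0))

theorem isTraceKernel_reducedKernel : IsTraceKernel (reducedKernel ψ) where
  measurable := measurable_reducedKernel ψ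
  integrable_shift v := (integrable_ketBra_shift_left ψ v).integral_prod_left
  memLp := memLp_reducedKernel ψ

theorem kernelChar_reducedKernel (u v : ι → ℝ) :
    kernelChar (reducedKernel ψ) (Sum.elim u v) =
      inner ℂ ψ (weyl (Sum.elim (Sum.elim u 0) (Sum.elim v 0)) ψ) := by
  rw [← kernelChar_ketBra, kernelChar, kernelChar, integral_eq_integral_sumElim
    (integrable_exp_mul _ _ ((isTraceKernel_ketBra ψ ψ).integrable_shift _))]
  simp only [Sum.elim_comp_inl, Sum.elim_comp_inr, sumElim_dotProduct_sumElim, zero_dotProduct,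
    add_zero, sumElim_add_sumElim_zero, integral_const_mul]
  rfl

theorem dotProduct_leftBlock_mulVec (V : Matrix (Phase (ι ⊕ κ)) (Phase (ι ⊕ κ)) ℝ)
    (ξ : Phase ι → ℝ) : ξ ⬝ᵥ leftBlock V *ᵥ ξ =
      Sum.elim (Sum.elim (ξ ∘ Sum.inl) 0) (Sum.elim (ξ ∘ Sum.inr) 0) ⬝ᵥ
        V *ᵥ Sum.elim (Sum.elim (ξ ∘ Sum.inl) 0) (Sum.elim (ξ ∘ Sum.inr) 0) := by
  simp [leftBlock, dotProduct, mulVec, Fintype.sum_sum_type]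

variable {ψ} {V : Matrix (Phase (ι ⊕ κ)) (Phase (ι ⊕ κ)) ℝ} {d : Phase (ι ⊕ κ) → ℝ}

theorem HasGaussianChar.posDef_leftBlock (h : HasGaussianChar ψ V d) : (leftBlock V).PosDef := by
  classical
  exact (h.uncertainty.submatrix Sum.inl_injective).posDef (h.1.submatrix _)

theorem HasGaussianChar.posDef_rightBlock (h : HasGaussianChar ψ V d) :
    (rightBlock V).PosDef := by
  classical
  exact (h.uncertainty.submatrix Sum.inr_injective).posDef (h.1.submatrix _)

variable [DecidableEq ι]

theorem HasGaussianChar.uncertainty_leftBlock (h : HasGaussianChar ψ V d) :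
    Uncertainty (leftBlock V) := by
  classical
  exact h.uncertainty.submatrix Sum.inl_injective

theorem HasGaussianChar.reducedPurity_eq (h : HasGaussianChar ψ V d) :
    reducedPurity ψ = (√(leftBlock V).det)⁻¹ := by
  refine (isTraceKernel_reducedKernel ψ).integral_norm_sq_eq h.posDef_leftBlock fun ξ => ?_
  rw [dotProduct_leftBlock_mulVec, ← h.norm_inner_weyl, ← kernelChar_reducedKernel,
    Sum.elim_comp_inl_inr]

end ReducedKernel

section Triangular

variable {ι : Type} [Fintype ι]

theorem HasGaussianChar.map {φ : L2 ι} {M S : Matrix (Phase ι) (Phase ι) ℝ}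
    {d e : Phase ι → ℝ} (h : HasGaussianChar φ M d) {U : L2 ι ≃ₗᵢ[ℂ] L2 ι}
    (hU : ∀ (ξ : Phase ι → ℝ) (ψ : L2 ι),
      weyl ξ (U ψ) = Complex.exp (Complex.I * ((ξ ⬝ᵥ e : ℝ) : ℂ)) • U (weyl (Sᵀ *ᵥ ξ) ψ)) :
    HasGaussianChar (U φ) (S * M * Sᵀ) (S *ᵥ d + e) := by
  classical
  refine ⟨by rw [IsSymm, transpose_mul, transpose_mul, transpose_transpose, h.1, Matrix.mul_assoc],
    fun ξ => ?_⟩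
  rw [hU, inner_smul_right, U.inner_map_map, h.2, ← Complex.exp_add, ← dotProduct_conj_mulVec,
    mulVec_transpose, ← dotProduct_mulVec, dotProduct_add]
  congr 1
  push_cast
  ring

/-- `x ↦ |det L|^{1/2} e^{i x·Cx/2} ψ(L x)`, the action of the symplectic matrix `triMat L C` on
wave functions. -/
noncomputable def triFun [DecidableEq ι] (L C : Matrix ι ι ℝ) (ψ : (ι → ℝ) → ℂ) (x : ι → ℝ) : ℂ :=
  ((√|L.det| : ℝ) : ℂ) * Complex.exp (Complex.I * ((x ⬝ᵥ C *ᵥ x / 2 : ℝ) : ℂ)) * ψ (L *ᵥ x)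

variable [DecidableEq ι] {L : Matrix ι ι ℝ}

theorem norm_triFun (L C : Matrix ι ι ℝ) (ψ : (ι → ℝ) → ℂ) (x : ι → ℝ) :
    ‖triFun L C ψ x‖ = √|L.det| * ‖ψ (L *ᵥ x)‖ := by
  rw [triFun, norm_mul, norm_mul, mul_comm Complex.I, Complex.norm_exp_ofReal_mul_I, mul_one,
    Complex.norm_real, Real.norm_of_nonneg (Real.sqrt_nonneg _)]

theorem ae_comp_mulVec (hL : IsUnit L.det) {p : (ι → ℝ) → Prop} (h : ∀ᵐ x, p x) :
    ∀ᵐ x : ι → ℝ, p (L *ᵥ x) := by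
  refine (measurableEmbedding_mulVec hL).ae_map_iff.1 ?_
  rw [map_mulVec_volume hL]
  exact Measure.ae_smul_measure h _

theorem memLp_triFun (hL : IsUnit L.det) (C : Matrix ι ι ℝ) (ψ : L2 ι) :
    MemLp (triFun L C ψ) 2 volume := by
  have hcomp : MemLp (fun x : ι → ℝ => ψ (L *ᵥ x)) 2 volume := by
    refine (measurableEmbedding_mulVec hL).memLp_map_measure_iff.1 ?_
    rw [map_mulVec_volume hL]
    exact (Lp.memLp ψ).smul_measure ENNReal.ofReal_ne_top
  have hphase : Continuous fun x : ι → ℝ =>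
      Complex.exp (Complex.I * ((x ⬝ᵥ C *ᵥ x / 2 : ℝ) : ℂ)) := by
    have : Continuous fun x : ι → ℝ => x ⬝ᵥ C *ᵥ x :=
      continuous_id.dotProduct (continuous_const.matrix_mulVec continuous_id)
    fun_prop
  refine (hcomp.const_mul ((√|L.det| : ℝ) : ℂ)).of_le
    ((continuous_const.mul hphase).aestronglyMeasurable.mul hcomp.1) (.of_forall fun x => ?_)
  rw [norm_triFun, norm_mul, Complex.norm_real, Real.norm_of_nonneg (Real.sqrt_nonneg _)]

/-- The operator `ψ ↦ |det L|^{1/2} e^{i x·Cx/2} ψ(L x)` on `L2 ι`. -/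
noncomputable def triOp (hL : IsUnit L.det) (C : Matrix ι ι ℝ) (ψ : L2 ι) : L2 ι :=
  (memLp_triFun hL C ψ).toLp _

theorem coeFn_triOp (hL : IsUnit L.det) (C : Matrix ι ι ℝ) (ψ : L2 ι) :
    triOp hL C ψ =ᵐ[volume] triFun L C ψ :=
  MemLp.coeFn_toLp _

theorem triOp_eq_of_ae_eq (hL : IsUnit L.det) (C : Matrix ι ι ℝ) {ψ φ : L2 ι}
    (h : φ =ᵐ[volume] triFun L C ψ) : triOp hL C ψ = φ :=
  Lp.ext ((coeFn_triOp hL C ψ).trans h.symm)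

theorem norm_triOp (hL : IsUnit L.det) (C : Matrix ι ι ℝ) (ψ : L2 ι) : ‖triOp hL C ψ‖ = ‖ψ‖ := by
  refine (pow_left_inj₀ (norm_nonneg _) (norm_nonneg _) two_ne_zero).1 ?_
  calc ‖triOp hL C ψ‖ ^ 2 = ∫ x, ‖triOp hL C ψ x‖ ^ 2 := norm_sq_eq_integral _
    _ = ∫ x, |L.det| * ‖ψ (L *ᵥ x)‖ ^ 2 := by
        refine integral_congr_ae ?_
        filter_upwards [coeFn_triOp hL C ψ] with x hx
        rw [hx, norm_triFun, mul_pow, Real.sq_sqrt (abs_nonneg _)]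
    _ = ∫ x, ‖ψ x‖ ^ 2 := by
        rw [integral_const_mul, integral_comp_mulVec hL (fun y => ‖ψ y‖ ^ 2), smul_eq_mul,
          mul_inv_cancel_left₀ (abs_ne_zero.2 hL.ne_zero)]
    _ = ‖ψ‖ ^ 2 := (norm_sq_eq_integral _).symm

/-- `triOp` as a linear isometry. -/
noncomputable def triIsometry (hL : IsUnit L.det) (C : Matrix ι ι ℝ) : L2 ι →ₗᵢ[ℂ] L2 ι where
  toFun := triOp hL C
  map_add' ψ φ := by
    refine triOp_eq_of_ae_eq hL C ?_
    filter_upwards [Lp.coeFn_add (triOp hL C ψ) (triOp hL C φ), coeFn_triOp hL C ψ,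
      coeFn_triOp hL C φ, ae_comp_mulVec hL (Lp.coeFn_add ψ φ)] with x hadd hψ hφ hsum
    rw [hadd, Pi.add_apply, hψ, hφ, triFun, triFun, triFun, hsum, Pi.add_apply, mul_add]
  map_smul' c ψ := by
    refine triOp_eq_of_ae_eq hL C ?_
    filter_upwards [Lp.coeFn_smul c (triOp hL C ψ), coeFn_triOp hL C ψ,
      ae_comp_mulVec hL (Lp.coeFn_smul c ψ)] with x hsmul hψ hcψ
    rw [RingHom.id_apply, hsmul, Pi.smul_apply, hψ, triFun, triFun, hcψ, Pi.smul_apply,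
      smul_eq_mul, smul_eq_mul, mul_left_comm]
  norm_map' := norm_triOp hL C

theorem triOp_triOp_nonsing_inv (hL : IsUnit L.det) (C : Matrix ι ι ℝ) (ψ : L2 ι) :
    triOp hL C (triOp (isUnit_nonsing_inv_det L hL) (-(L⁻¹ᵀ * C * L⁻¹)) ψ) = ψ := by
  refine triOp_eq_of_ae_eq hL C ?_
  filter_upwards [ae_comp_mulVec hL (coeFn_triOp (isUnit_nonsing_inv_det L hL)
    (-(L⁻¹ᵀ * C * L⁻¹)) ψ)] with x hx
  have hcancel : L⁻¹ *ᵥ L *ᵥ x = x := by rw [mulVec_mulVec, nonsing_inv_mul _ hL, one_mulVec]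
  have hquad : (L *ᵥ x) ⬝ᵥ -(L⁻¹ᵀ * C * L⁻¹) *ᵥ L *ᵥ x = -(x ⬝ᵥ C *ᵥ x) := by
    rw [neg_mulVec, dotProduct_neg, ← mulVec_mulVec, hcancel, ← mulVec_mulVec, dotProduct_mulVec,
      vecMul_transpose, hcancel]
  have hdet : ((√|L.det| : ℝ) : ℂ) * ((√|L⁻¹.det| : ℝ) : ℂ) = 1 := by
    rw [← Complex.ofReal_mul, ← Real.sqrt_mul (abs_nonneg _), ← abs_mul, ← det_mul,
      mul_nonsing_inv _ hL, det_one, abs_one, Real.sqrt_one, Complex.ofReal_one]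
  have hphase : Complex.exp (Complex.I * ((x ⬝ᵥ C *ᵥ x / 2 : ℝ) : ℂ)) *
      Complex.exp (Complex.I * ((-(x ⬝ᵥ C *ᵥ x) / 2 : ℝ) : ℂ)) = 1 := by
    rw [← Complex.exp_add, ← mul_add, ← Complex.ofReal_add]
    simp [neg_div]
  rw [triFun, hx, triFun, hcancel, hquad, ← mul_assoc (_ * _) (_ * _) (ψ x), mul_mul_mul_comm,
    hdet, hphase, one_mul, one_mul]

/-- The Gaussian unitary `ψ ↦ |det L|^{1/2} e^{i x·Cx/2} ψ(L x)` implementing `triMat L C`. -/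
noncomputable def triUnitary (hL : IsUnit L.det) (C : Matrix ι ι ℝ) : L2 ι ≃ₗᵢ[ℂ] L2 ι :=
  LinearIsometryEquiv.ofSurjective (triIsometry hL C) fun ψ => ⟨_, triOp_triOp_nonsing_inv hL C ψ⟩

theorem coeFn_triUnitary (hL : IsUnit L.det) (C : Matrix ι ι ℝ) (ψ : L2 ι) :
    triUnitary hL C ψ =ᵐ[volume] triFun L C ψ :=
  coeFn_triOp hL C ψ

variable {C : Matrix ι ι ℝ}

theorem triMat_transpose_mulVec (hC : C.IsSymm) (ξ : Phase ι → ℝ) :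
    (triMat L C)ᵀ *ᵥ ξ = Sum.elim (L⁻¹ᵀ *ᵥ (ξ ∘ Sum.inl + C *ᵥ (ξ ∘ Sum.inr)))
      (L *ᵥ (ξ ∘ Sum.inr)) := by
  rw [triMat, fromBlocks_transpose, fromBlocks_mulVec, transpose_mul, hC, transpose_transpose,
    transpose_zero, zero_mulVec, zero_add, mulVec_add, mulVec_mulVec]

/- Completing the square: shifting the chirp `e^{i x·Cx/2}` by `v` adds the linear phase `Cv·x`. -/
theorem weylFun_triFun (hL : IsUnit L.det) (hC : C.IsSymm) (ξ : Phase ι → ℝ)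
    (ψ : (ι → ℝ) → ℂ) :
    weylFun ξ (triFun L C ψ) = triFun L C (weylFun ((triMat L C)ᵀ *ᵥ ξ) ψ) := by
  funext x
  rw [triMat_transpose_mulVec hC, weylFun, triFun, triFun, weylFun, Sum.elim_comp_inl,
    Sum.elim_comp_inr, ← mulVec_add]
  set u := ξ ∘ Sum.inl
  set v := ξ ∘ Sum.inr
  have hlin (y : ι → ℝ) : (L⁻¹ᵀ *ᵥ (u + C *ᵥ v)) ⬝ᵥ L *ᵥ y = u ⬝ᵥ y + v ⬝ᵥ C *ᵥ y := by
    rw [mulVec_transpose, ← dotProduct_mulVec, mulVec_mulVec, nonsing_inv_mul _ hL, one_mulVec,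
      add_dotProduct, dotProduct_mulVec, ← mulVec_transpose, hC]
  have hcomm : v ⬝ᵥ C *ᵥ x = x ⬝ᵥ C *ᵥ v := by
    rw [dotProduct_mulVec, ← mulVec_transpose, hC, dotProduct_comm]
  have hphase : Complex.exp (Complex.I * ((u ⬝ᵥ x + u ⬝ᵥ v / 2 : ℝ) : ℂ)) *
        Complex.exp (Complex.I * (((x + v) ⬝ᵥ C *ᵥ (x + v) / 2 : ℝ) : ℂ)) =
      Complex.exp (Complex.I * ((x ⬝ᵥ C *ᵥ x / 2 : ℝ) : ℂ)) *
        Complex.exp (Complex.I * (((L⁻¹ᵀ *ᵥ (u + C *ᵥ v)) ⬝ᵥ L *ᵥ x +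
          (L⁻¹ᵀ *ᵥ (u + C *ᵥ v)) ⬝ᵥ L *ᵥ v / 2 : ℝ) : ℂ)) := by
    rw [← Complex.exp_add, ← Complex.exp_add, hlin, hlin]
    simp only [mulVec_add, dotProduct_add, add_dotProduct, hcomm]
    congr 1
    push_cast
    ring
  linear_combination ((√|L.det| : ℝ) : ℂ) * ψ (L *ᵥ (x + v)) * hphase

theorem weyl_triUnitary (hL : IsUnit L.det) (hC : C.IsSymm) (ξ : Phase ι → ℝ) (ψ : L2 ι) :
    weyl ξ (triUnitary hL C ψ) = triUnitary hL C (weyl ((triMat L C)ᵀ *ᵥ ξ) ψ) := by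
  refine weyl_eq_of_ae_eq ?_
  filter_upwards [coeFn_triUnitary hL C (weyl ((triMat L C)ᵀ *ᵥ ξ) ψ),
    ae_comp_mulVec hL (coeFn_weyl ((triMat L C)ᵀ *ᵥ ξ) ψ),
    ae_comp_add_right (coeFn_triUnitary hL C ψ) (ξ ∘ Sum.inr)] with x houter hweyl hinner
  have hlhs : weylFun ξ (triUnitary hL C ψ) x = weylFun ξ (triFun L C ψ) x := by
    rw [weylFun, hinner, weylFun]
  rw [hlhs, weylFun_triFun hL hC, houter, triFun, hweyl, triFun]

theorem isGaussianUnitary_triUnitary (hL : IsUnit L.det) (hC : C.IsSymm) :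
    IsGaussianUnitary (triUnitary hL C) :=
  ⟨triMat L C, triMat_mem_symplecticGroup hL hC, 0, fun ξ ψ => by simp [weyl_triUnitary hL hC]⟩

theorem HasGaussianChar.map_triUnitary {φ : L2 ι} {M : Matrix (Phase ι) (Phase ι) ℝ}
    (h : HasGaussianChar φ M 0) (hL : IsUnit L.det) (hC : C.IsSymm) :
    HasGaussianChar (triUnitary hL C φ) (triMat L C * M * (triMat L C)ᵀ) 0 := by
  simpa using h.map (S := triMat L C) (e := 0) fun ξ ψ => by simp [weyl_triUnitary hL hC]

end Triangular

section Vacuum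

variable (ι : Type) [Fintype ι]

/-- The wave function `π^{-n/4} e^{-x·x/2}` of the vacuum of `n` modes. -/
noncomputable def vacFun (x : ι → ℝ) : ℂ :=
  ((Real.pi ^ (-(Fintype.card ι : ℝ) / 4) * Real.exp (-(x ⬝ᵥ x) / 2) : ℝ) : ℂ)

variable {ι} in
theorem vacFun_mul_vacFun (x y : ι → ℝ) : vacFun ι x * vacFun ι y =
    ((Real.pi ^ (-(Fintype.card ι : ℝ) / 2) * Real.exp (-(x ⬝ᵥ x + y ⬝ᵥ y) / 2) : ℝ) : ℂ) := by
  rw [vacFun, vacFun, ← Complex.ofReal_mul, mul_mul_mul_comm, ← Real.rpow_add Real.pi_pos,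
    ← Real.exp_add]
  ring_nf

theorem memLp_vacFun : MemLp (vacFun ι) 2 volume := by
  have hcont : Continuous (vacFun ι) := by
    unfold vacFun dotProduct
    fun_prop
  rw [memLp_two_iff_integrable_sq_norm hcont.aestronglyMeasurable]
  have hgauss : Integrable fun x : ι → ℝ => Real.exp (-1 * (x ⬝ᵥ x)) :=
    .of_integral_ne_zero (by rw [integral_exp_neg_mul_dotProduct_self]; positivity)
  refine (hgauss.const_mul (Real.pi ^ (-(Fintype.card ι : ℝ) / 2))).congr (.of_forall fun x => ?_)
  beta_reduce
  rw [sq, ← norm_mul, vacFun_mul_vacFun, Complex.norm_real, Real.norm_of_nonneg (by positivity)]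
  ring_nf

/-- The vacuum, i.e. the ground state of the Hamiltonian. -/
noncomputable def vac : L2 ι :=
  (memLp_vacFun ι).toLp _

theorem coeFn_vac : vac ι =ᵐ[volume] vacFun ι :=
  MemLp.coeFn_toLp _

theorem inner_vac_weyl_vac (ξ : Phase ι → ℝ) :
    inner ℂ (vac ι) (weyl ξ (vac ι)) = ∫ x, vacFun ι x * weylFun ξ (vacFun ι) x := by
  rw [L2.inner_def]
  refine integral_congr_ae ?_
  filter_upwards [coeFn_vac ι, coeFn_weyl ξ (vac ι), ae_comp_add_right (coeFn_vac ι) (ξ ∘ Sum.inr)]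
    with x hx hweyl hshift
  rw [RCLike.inner_apply, hweyl, hx, weylFun, hshift, weylFun, mul_comm]
  congr 1
  exact Complex.conj_ofReal _

variable {ι}

theorem vacFun_mul_weylFun_vacFun (u v x : ι → ℝ) :
    vacFun ι x * weylFun (Sum.elim u v) (vacFun ι) x =
      (Real.pi : ℂ) ^ (-(Fintype.card ι : ℂ) / 2) *
        Complex.exp (Complex.I * (u ⬝ᵥ v / 2 : ℝ) - (v ⬝ᵥ v / 2 : ℝ)) *
        Complex.exp (-1 * ∑ j, (x j : ℂ) ^ 2 + ∑ j, (Complex.I * u j - v j) * x j) := by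
  have hadd : (x + v) ⬝ᵥ (x + v) = x ⬝ᵥ x + 2 * (v ⬝ᵥ x) + v ⬝ᵥ v := by
    rw [dotProduct_add, add_dotProduct, add_dotProduct, dotProduct_comm x v]
    ring
  have hsum : -1 * ∑ j, (x j : ℂ) ^ 2 + ∑ j, (Complex.I * u j - v j) * x j =
      -(x ⬝ᵥ x : ℝ) + Complex.I * (u ⬝ᵥ x : ℝ) - (v ⬝ᵥ x : ℝ) := by
    simp only [dotProduct, sub_mul, Finset.sum_sub_distrib, Finset.mul_sum, sq, mul_assoc,
      Complex.ofReal_sum, Complex.ofReal_mul, neg_mul, one_mul, Finset.sum_neg_distrib]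
    ring
  rw [hsum, weylFun, Sum.elim_comp_inl, Sum.elim_comp_inr, mul_left_comm, vacFun_mul_vacFun, hadd,
    Complex.ofReal_mul, Complex.ofReal_exp, Complex.ofReal_cpow Real.pi_nonneg, mul_left_comm,
    mul_assoc, ← Complex.exp_add, ← Complex.exp_add]
  push_cast
  ring_nf

theorem hasGaussianChar_vac [DecidableEq ι] : HasGaussianChar (vac ι) 1 0 := by
  refine ⟨isSymm_one, fun ξ => ?_⟩
  obtain ⟨u, v, rfl⟩ : ∃ u v : ι → ℝ, ξ = Sum.elim u v := ⟨_, _, (Sum.elim_comp_inl_inr ξ).symm⟩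
  have hsq : ∑ j, (Complex.I * u j - v j) ^ 2 =
      -(u ⬝ᵥ u : ℝ) - 2 * Complex.I * (u ⬝ᵥ v : ℝ) + (v ⬝ᵥ v : ℝ) := by
    simp only [sub_sq, mul_pow, Complex.I_sq, Finset.sum_add_distrib, Finset.sum_sub_distrib]
    simp [dotProduct, Finset.mul_sum, sq, mul_assoc]
  have hpi : (Real.pi : ℂ) ^ (-(Fintype.card ι : ℂ) / 2) * (Real.pi : ℂ) ^ (Fintype.card ι / 2 : ℂ)
      = 1 := by
    rw [← Complex.cpow_add _ _ (Complex.ofReal_ne_zero.2 Real.pi_ne_zero), neg_div, neg_add_cancel,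
      Complex.cpow_zero]
  simp_rw [inner_vac_weyl_vac, vacFun_mul_weylFun_vacFun]
  rw [integral_const_mul, GaussianFourier.integral_cexp_neg_mul_sum_add (by simp), div_one,
    mul_mul_mul_comm, hpi, one_mul, ← Complex.exp_add, hsq, one_mulVec,
    sumElim_dotProduct_sumElim, dotProduct_zero]
  congr 1
  push_cast
  ring

end Vacuum

section Tensor

variable {ι κ : Type} [Fintype ι] [Fintype κ]

theorem memLp_tensor (f : L2 ι) (g : L2 κ) :
    MemLp (fun z : ι ⊕ κ → ℝ => f (z ∘ Sum.inl) * g (z ∘ Sum.inr)) 2 volume :=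
  (memLp_two_mul_prod (Lp.memLp f) (Lp.memLp g)).comp_measurePreserving
    measurePreserving_comp_inl_comp_inr

/-- The tensor product `f ⊗ g`. -/
noncomputable def tensor (f : L2 ι) (g : L2 κ) : L2 (ι ⊕ κ) :=
  (memLp_tensor f g).toLp _

theorem isTensor_tensor (f : L2 ι) (g : L2 κ) : IsTensor (tensor f g) f g :=
  MemLp.coeFn_toLp _

theorem isTensor_vac : IsTensor (vac (ι ⊕ κ)) (vac ι) (vac κ) := by
  unfold IsTensor
  filter_upwards [coeFn_vac (ι ⊕ κ), ae_comp_inl (coeFn_vac ι), ae_comp_inr (coeFn_vac κ)]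
    with z h hι hκ
  have hsum : z ⬝ᵥ z = (z ∘ Sum.inl) ⬝ᵥ (z ∘ Sum.inl) + (z ∘ Sum.inr) ⬝ᵥ (z ∘ Sum.inr) :=
    Fintype.sum_sum_type _
  rw [h, hι, hκ, vacFun, vacFun, vacFun, ← Complex.ofReal_mul, mul_mul_mul_comm,
    ← Real.rpow_add Real.pi_pos, ← Real.exp_add, hsum, Fintype.card_sum]
  push_cast
  ring_nf

variable {h h' : L2 (ι ⊕ κ)} {f f' : L2 ι} {g g' : L2 κ}

theorem IsTensor.unique (hfg : IsTensor h f g) (hfg' : IsTensor h' f g) : h = h' :=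
  Lp.ext (hfg.trans hfg'.symm)

theorem IsTensor.smul (hfg : IsTensor h f g) (a b : ℂ) :
    IsTensor ((a * b) • h) (a • f) (b • g) := by
  unfold IsTensor at hfg ⊢
  filter_upwards [hfg, Lp.coeFn_smul (a * b) h, ae_comp_inl (κ := κ) (Lp.coeFn_smul a f),
    ae_comp_inr (ι := ι) (Lp.coeFn_smul b g)] with z hz hh hf hg
  rw [hh, hf, hg, Pi.smul_apply, Pi.smul_apply, Pi.smul_apply, hz, smul_eq_mul, smul_eq_mul,
    smul_eq_mul, mul_mul_mul_comm]

theorem IsTensor.inner_eq (hfg : IsTensor h f g) (hfg' : IsTensor h' f' g') :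
    inner ℂ h h' = inner ℂ f f' * inner ℂ g g' := by
  have hprod : (fun z => inner ℂ (h z) (h' z)) =ᵐ[volume] fun z =>
      inner ℂ (f (z ∘ Sum.inl)) (f' (z ∘ Sum.inl)) *
        inner ℂ (g (z ∘ Sum.inr)) (g' (z ∘ Sum.inr)) := by
    filter_upwards [hfg, hfg'] with z hz hz'
    simp only [hz, hz', RCLike.inner_apply, map_mul]
    ring
  have hemb := (MeasurableEquiv.sumPiEquivProdPi fun _ : ι ⊕ κ => ℝ).measurableEmbedding
  rw [L2.inner_def, L2.inner_def, L2.inner_def, integral_congr_ae hprod, ← integral_prod_mul]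
  exact measurePreserving_comp_inl_comp_inr.integral_comp hemb fun p =>
    inner ℂ (f p.1) (f' p.1) * inner ℂ (g p.2) (g' p.2)

theorem IsTensor.map_weyl (hfg : IsTensor h f g) (ξ : Phase (ι ⊕ κ) → ℝ) :
    IsTensor (weyl ξ h) (weyl (ξ ∘ Sum.map Sum.inl Sum.inl) f)
      (weyl (ξ ∘ Sum.map Sum.inr Sum.inr) g) := by
  unfold IsTensor at hfg ⊢
  filter_upwards [coeFn_weyl ξ h, ae_comp_add_right hfg (ξ ∘ Sum.inr),
    ae_comp_inl (κ := κ) (coeFn_weyl (ξ ∘ Sum.map Sum.inl Sum.inl) f),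
    ae_comp_inr (ι := ι) (coeFn_weyl (ξ ∘ Sum.map Sum.inr Sum.inr) g)] with z hξ hz hf hg
  have hphase (a b c d : ℝ) : Complex.exp (Complex.I * ((a + b + (c + d) / 2 : ℝ) : ℂ)) =
      Complex.exp (Complex.I * ((a + c / 2 : ℝ) : ℂ)) *
        Complex.exp (Complex.I * ((b + d / 2 : ℝ) : ℂ)) := by
    rw [← Complex.exp_add]
    push_cast
    ring_nf
  have hsum (x y : ι ⊕ κ → ℝ) :
      x ⬝ᵥ y = (x ∘ Sum.inl) ⬝ᵥ (y ∘ Sum.inl) + (x ∘ Sum.inr) ⬝ᵥ (y ∘ Sum.inr) :=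
    Fintype.sum_sum_type _
  rw [hξ, hf, hg, weylFun, weylFun, weylFun, hz, hsum _ z, hsum (ξ ∘ Sum.inl), hphase]
  exact mul_mul_mul_comm _ _ _ _

variable [DecidableEq ι] [DecidableEq κ] {L C : Matrix ι ι ℝ} {L' C' : Matrix κ κ ℝ}

theorem isUnit_det_fromBlocks (hL : IsUnit L.det) (hL' : IsUnit L'.det) :
    IsUnit (fromBlocks L 0 0 L').det := by
  rw [det_fromBlocks_zero₂₁]
  exact hL.mul hL'

theorem triFun_fromBlocks (f : (ι → ℝ) → ℂ) (g : (κ → ℝ) → ℂ) (z : ι ⊕ κ → ℝ) :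
    triFun (fromBlocks L 0 0 L') (fromBlocks C 0 0 C')
        (fun z => f (z ∘ Sum.inl) * g (z ∘ Sum.inr)) z =
      triFun L C f (z ∘ Sum.inl) * triFun L' C' g (z ∘ Sum.inr) := by
  obtain ⟨x, y, rfl⟩ : ∃ x y, z = Sum.elim x y := ⟨_, _, (Sum.elim_comp_inl_inr z).symm⟩
  simp only [triFun, det_fromBlocks_zero₂₁, abs_mul, Real.sqrt_mul (abs_nonneg _),
    fromBlocks_mulVec, Sum.elim_comp_inl, Sum.elim_comp_inr, zero_mulVec, add_zero, zero_add,
    sumElim_dotProduct_sumElim, add_div, Complex.ofReal_add, mul_add, Complex.exp_add,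
    Complex.ofReal_mul]
  ring

theorem IsTensor.map_triUnitary (hfg : IsTensor h f g) (hL : IsUnit L.det)
    (hL' : IsUnit L'.det) :
    IsTensor (triUnitary (isUnit_det_fromBlocks hL hL') (fromBlocks C 0 0 C') h)
      (triUnitary hL C f) (triUnitary hL' C' g) := by
  unfold IsTensor at hfg ⊢
  filter_upwards [coeFn_triUnitary (isUnit_det_fromBlocks hL hL') (fromBlocks C 0 0 C') h,
    ae_comp_mulVec (isUnit_det_fromBlocks hL hL') hfg,
    ae_comp_inl (κ := κ) (coeFn_triUnitary hL C f),
    ae_comp_inr (ι := ι) (coeFn_triUnitary hL' C' g)] with z hz hh hf hg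
  rw [hz, hf, hg, ← triFun_fromBlocks, triFun, hh, triFun]

theorem isLocalGaussianUnitary_triUnitary (hL : IsUnit L.det) (hL' : IsUnit L'.det)
    (hC : C.IsSymm) (hC' : C'.IsSymm) :
    IsLocalGaussianUnitary (triUnitary (isUnit_det_fromBlocks hL hL') (fromBlocks C 0 0 C')) :=
  ⟨triUnitary hL C, triUnitary hL' C', isGaussianUnitary_triUnitary hL hC,
    isGaussianUnitary_triUnitary hL' hC', fun _ _ _ hfg => hfg.map_triUnitary hL hL'⟩

end Tensor

section LocalUnitaries

variable {ι κ : Type} [Fintype ι] [Fintype κ]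

theorem dirSum_mulVec_comp_inl (S : Matrix (Phase ι) (Phase ι) ℝ)
    (T : Matrix (Phase κ) (Phase κ) ℝ) (ξ : Phase (ι ⊕ κ) → ℝ) :
    (dirSum S T *ᵥ ξ) ∘ Sum.map Sum.inl Sum.inl = S *ᵥ (ξ ∘ Sum.map Sum.inl Sum.inl) := by
  ext (k | k) <;> simp [dirSum, mulVec, dotProduct]

theorem dirSum_mulVec_comp_inr (S : Matrix (Phase ι) (Phase ι) ℝ)
    (T : Matrix (Phase κ) (Phase κ) ℝ) (ξ : Phase (ι ⊕ κ) → ℝ) :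
    (dirSum S T *ᵥ ξ) ∘ Sum.map Sum.inr Sum.inr = T *ᵥ (ξ ∘ Sum.map Sum.inr Sum.inr) := by
  ext (k | k) <;> simp [dirSum, mulVec, dotProduct]

theorem dotProduct_sumElim_comp_sumSumSumComm (ξ : Phase (ι ⊕ κ) → ℝ) (d : Phase ι → ℝ)
    (e : Phase κ → ℝ) : ξ ⬝ᵥ (Sum.elim d e ∘ Equiv.sumSumSumComm ι κ ι κ) =
      (ξ ∘ Sum.map Sum.inl Sum.inl) ⬝ᵥ d + (ξ ∘ Sum.map Sum.inr Sum.inr) ⬝ᵥ e := by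
  rw [dotProduct, ← (Equiv.sumSumSumComm ι κ ι κ).symm.sum_comp, Fintype.sum_sum_type]
  congr 1 <;> refine Finset.sum_congr rfl fun k _ => ?_ <;> rcases k with k | k <;> rfl

theorem continuousLinearMap_eq_of_eqOn_weyl {φ : L2 ι} (hφ : φ ≠ 0) {A B : L2 ι →L[ℂ] L2 ι}
    (h : ∀ ξ, A (weyl ξ φ) = B (weyl ξ φ)) : A = B :=
  ContinuousLinearMap.ext_on
    (Submodule.dense_iff_topologicalClosure_eq_top.2 (topologicalClosure_span_weyl hφ))
    (Set.forall_mem_range.2 h)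

variable [DecidableEq ι] [DecidableEq κ]

/- The identity is clear on product vectors, and the Weyl orbit of the product vector `vac` is
total. -/
theorem IsLocalGaussianUnitary.exists_dirSum {U : L2 (ι ⊕ κ) ≃ₗᵢ[ℂ] L2 (ι ⊕ κ)}
    (hU : IsLocalGaussianUnitary U) :
    ∃ S ∈ symplecticGroup ι ℝ, ∃ T ∈ symplecticGroup κ ℝ, ∃ d : Phase (ι ⊕ κ) → ℝ,
      ∀ (ξ : Phase (ι ⊕ κ) → ℝ) (ψ : L2 (ι ⊕ κ)), weyl ξ (U ψ) =
        Complex.exp (Complex.I * ((ξ ⬝ᵥ d : ℝ) : ℂ)) • U (weyl ((dirSum S T)ᵀ *ᵥ ξ) ψ) := by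
  obtain ⟨U₁, U₂, ⟨S, hS, d₁, h₁⟩, ⟨T, hT, d₂, h₂⟩, hten⟩ := hU
  refine ⟨S, hS, T, hT, Sum.elim d₁ d₂ ∘ Equiv.sumSumSumComm ι κ ι κ, fun ξ => ?_⟩
  have hproduct {h : L2 (ι ⊕ κ)} {f : L2 ι} {g : L2 κ} (hfg : IsTensor h f g) :
      weyl ξ (U h) = Complex.exp (Complex.I *
        ((ξ ⬝ᵥ (Sum.elim d₁ d₂ ∘ Equiv.sumSumSumComm ι κ ι κ) : ℝ) : ℂ)) •
          U (weyl ((dirSum S T)ᵀ *ᵥ ξ) h) := by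
    have hleft := (hten _ _ _ hfg).map_weyl ξ
    have hright := hten _ _ _ (hfg.map_weyl ((dirSum S T)ᵀ *ᵥ ξ))
    rw [dirSum_transpose, dirSum_mulVec_comp_inl, dirSum_mulVec_comp_inr, ← dirSum_transpose]
      at hright
    rw [h₁, h₂] at hleft
    rw [dotProduct_sumElim_comp_sumSumSumComm, Complex.ofReal_add, mul_add, Complex.exp_add]
    exact hleft.unique (hright.smul _ _)
  have hvac : vac (ι ⊕ κ) ≠ 0 := norm_ne_zero_iff.1 <| by
    rw [hasGaussianChar_vac.norm_eq_one]
    exact one_ne_zero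
  let A : L2 (ι ⊕ κ) →L[ℂ] L2 (ι ⊕ κ) :=
    (weylIsometry ξ).toContinuousLinearMap ∘L (U.toContinuousLinearEquiv : _ →L[ℂ] _)
  let B : L2 (ι ⊕ κ) →L[ℂ] L2 (ι ⊕ κ) :=
    Complex.exp (Complex.I *
        ((ξ ⬝ᵥ (Sum.elim d₁ d₂ ∘ Equiv.sumSumSumComm ι κ ι κ) : ℝ) : ℂ)) •
      ((U.toContinuousLinearEquiv : _ →L[ℂ] _) ∘L
        (weylIsometry ((dirSum S T)ᵀ *ᵥ ξ)).toContinuousLinearMap)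
  have hAB : A = B := continuousLinearMap_eq_of_eqOn_weyl hvac fun η =>
    hproduct (isTensor_vac.map_weyl η)
  exact fun ψ => congrArg (fun F : L2 (ι ⊕ κ) →L[ℂ] L2 (ι ⊕ κ) => F ψ) hAB

end LocalUnitaries

section Minima

variable {ι : Type} [Fintype ι] [DecidableEq ι] {φ : L2 ι} {V : Matrix (Phase ι) (Phase ι) ℝ}
  {d : Phase ι → ℝ} {ν : ι → ℝ}

theorem HasGaussianChar.exists_eq_mul_transpose (h : HasGaussianChar φ V d) :
    ∃ S ∈ symplecticGroup ι ℝ, V = S * Sᵀ :=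
  h.uncertainty.exists_eq_mul_transpose_of_det_eq_one h.1 h.det_eq_one

theorem HasGaussianChar.mem_symplecticGroup (h : HasGaussianChar φ V d) :
    V ∈ symplecticGroup ι ℝ := by
  obtain ⟨S, hS, rfl⟩ := h.exists_eq_mul_transpose
  exact mul_mem hS (SymplecticGroup.transpose_mem hS)

theorem HasGaussianChar.isSymplecticSpectrum_one (h : HasGaussianChar φ V d) :
    IsSymplecticSpectrum V 1 := by
  obtain ⟨S, hS, rfl⟩ := h.exists_eq_mul_transpose
  have hdet := isUnit_det_of_mem_symplecticGroup hS
  refine ⟨fun _ => one_pos, S⁻¹, inv_mem_symplecticGroup hS, ?_⟩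
  rw [Matrix.mul_assoc, Matrix.mul_assoc, ← transpose_mul, nonsing_inv_mul S hdet,
    transpose_one, Matrix.mul_one, nonsing_inv_mul S hdet, diagonal_one', fromBlocks_one]

theorem HasGaussianChar.energy_ne_top (h : HasGaussianChar φ V d) : energy φ ≠ ⊤ :=
  h.energy_eq ▸ ENNReal.ofReal_ne_top

theorem HasGaussianChar.ofReal_trace_le_energy (h : HasGaussianChar φ V d) :
    ENNReal.ofReal (V.trace / 4) ≤ energy φ := by
  rw [h.energy_eq]
  have hd : 0 ≤ d ⬝ᵥ d := Finset.sum_nonneg fun _ _ => mul_self_nonneg _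
  exact ENNReal.ofReal_le_ofReal (by linarith)

theorem HasGaussianChar.le_energy_of_isGaussianUnitary (h : HasGaussianChar φ V d)
    (hν : IsSymplecticSpectrum V ν) {U : L2 ι ≃ₗᵢ[ℂ] L2 ι} (hU : IsGaussianUnitary U) :
    ENNReal.ofReal ((∑ j, ν j) / 2) ≤ energy (U φ) := by
  obtain ⟨S, hS, e, hU⟩ := hU
  refine (ENNReal.ofReal_le_ofReal ?_).trans (h.map hU).ofReal_trace_le_energy
  linarith [hν.two_mul_sum_le_trace hS]

theorem HasGaussianChar.exists_isGaussianUnitary_energy_eq (h : HasGaussianChar φ V 0)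
    (hν : IsSymplecticSpectrum V ν) :
    ∃ U, IsGaussianUnitary U ∧ energy (U φ) = ENNReal.ofReal ((∑ j, ν j) / 2) := by
  obtain ⟨L, C, hL, hC, htrace⟩ := hν.exists_triMat_trace_eq
  refine ⟨triUnitary hL C, isGaussianUnitary_triUnitary hL hC, ?_⟩
  rw [(h.map_triUnitary hL hC).energy_eq, htrace, dotProduct_zero]
  ring_nf

theorem HasGaussianChar.globalMin_eq (h : HasGaussianChar φ V 0)
    (hν : IsSymplecticSpectrum V ν) : globalMin φ = ENNReal.ofReal ((∑ j, ν j) / 2) := by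
  obtain ⟨U, hU, henergy⟩ := h.exists_isGaussianUnitary_energy_eq hν
  exact le_antisymm (henergy ▸ iInf₂_le U hU)
    (le_iInf₂ fun _ hU => h.le_energy_of_isGaussianUnitary hν hU)

end Minima

section LocalMinima

variable {ι κ : Type} [Fintype ι] [DecidableEq ι] [Fintype κ] [DecidableEq κ] {ψ : L2 (ι ⊕ κ)}
  {V : Matrix (Phase (ι ⊕ κ)) (Phase (ι ⊕ κ)) ℝ} {d : Phase (ι ⊕ κ) → ℝ} {ν : ι → ℝ} {μ : κ → ℝ}

theorem HasGaussianChar.le_energy_of_isLocalGaussianUnitary (h : HasGaussianChar ψ V d)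
    (hν : IsSymplecticSpectrum (leftBlock V) ν) (hμ : IsSymplecticSpectrum (rightBlock V) μ)
    {U : L2 (ι ⊕ κ) ≃ₗᵢ[ℂ] L2 (ι ⊕ κ)} (hU : IsLocalGaussianUnitary U) :
    ENNReal.ofReal ((∑ j, ν j + ∑ k, μ k) / 2) ≤ energy (U ψ) := by
  obtain ⟨S, hS, T, hT, e, hU⟩ := hU.exists_dirSum
  refine (ENNReal.ofReal_le_ofReal ?_).trans (h.map hU).ofReal_trace_le_energy
  rw [trace_dirSum_conj S T h.1]
  linarith [hν.two_mul_sum_le_trace hS, hμ.two_mul_sum_le_trace hT]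

theorem exists_triMat_fromBlocks_trace_eq (hV : V.IsSymm)
    (hν : IsSymplecticSpectrum (leftBlock V) ν) (hμ : IsSymplecticSpectrum (rightBlock V) μ) :
    ∃ (L C : Matrix ι ι ℝ) (L' C' : Matrix κ κ ℝ), IsUnit L.det ∧ C.IsSymm ∧ IsUnit L'.det ∧
      C'.IsSymm ∧ (triMat (fromBlocks L 0 0 L') (fromBlocks C 0 0 C') * V *
        (triMat (fromBlocks L 0 0 L') (fromBlocks C 0 0 C'))ᵀ).trace =
          2 * (∑ j, ν j + ∑ k, μ k) := by
  obtain ⟨L, C, hL, hC, htrace⟩ := hν.exists_triMat_trace_eq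
  obtain ⟨L', C', hL', hC', htrace'⟩ := hμ.exists_triMat_trace_eq
  refine ⟨L, C, L', C', hL, hC, hL', hC', ?_⟩
  rw [triMat_fromBlocks hL hL', trace_dirSum_conj _ _ hV, htrace, htrace', mul_add]

theorem HasGaussianChar.exists_isLocalGaussianUnitary_energy_eq (h : HasGaussianChar ψ V 0)
    (hν : IsSymplecticSpectrum (leftBlock V) ν) (hμ : IsSymplecticSpectrum (rightBlock V) μ) :
    ∃ U, IsLocalGaussianUnitary U ∧
      energy (U ψ) = ENNReal.ofReal ((∑ j, ν j + ∑ k, μ k) / 2) := by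
  obtain ⟨L, C, L', C', hL, hC, hL', hC', htrace⟩ := exists_triMat_fromBlocks_trace_eq h.1 hν hμ
  refine ⟨_, isLocalGaussianUnitary_triUnitary hL hL' hC hC', ?_⟩
  have hU := h.map_triUnitary (isUnit_det_fromBlocks hL hL') (hC.fromBlocks transpose_zero hC')
  rw [hU.energy_eq, htrace, dotProduct_zero]
  ring_nf

theorem HasGaussianChar.localMin_eq (h : HasGaussianChar ψ V 0)
    (hν : IsSymplecticSpectrum (leftBlock V) ν) (hμ : IsSymplecticSpectrum (rightBlock V) μ) :
    localMin ψ = ENNReal.ofReal ((∑ j, ν j + ∑ k, μ k) / 2) := by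
  obtain ⟨U, hU, henergy⟩ := h.exists_isLocalGaussianUnitary_energy_eq hν hμ
  exact le_antisymm (henergy ▸ iInf₂_le U hU)
    (le_iInf₂ fun _ hU => h.le_energy_of_isLocalGaussianUnitary hν hμ hU)

theorem HasGaussianChar.ergotropicGap_eq (h : HasGaussianChar ψ V 0)
    (hν : IsSymplecticSpectrum (leftBlock V) ν) (hμ : IsSymplecticSpectrum (rightBlock V) μ) :
    ergotropicGap ψ = ∑ j, (ν j - 1) := by
  have hlocal : 0 ≤ ∑ j, ν j + ∑ k, μ k :=
    add_nonneg (Finset.sum_nonneg fun j _ => (hν.1 j).le)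
      (Finset.sum_nonneg fun k _ => (hμ.1 k).le)
  have hglobal : (0 : ℝ) ≤ ∑ j : ι ⊕ κ, (1 : ι ⊕ κ → ℝ) j :=
    Finset.sum_nonneg fun _ _ => zero_le_one
  have hcomplement := sum_sub_one_eq_of_isSymplecticSpectrum h.1 h.mem_symplecticGroup hν hμ
  calc ergotropicGap ψ = (∑ j, ν j + ∑ k, μ k) / 2 - (∑ j : ι ⊕ κ, (1 : ι ⊕ κ → ℝ) j) / 2 := by
        rw [ergotropicGap, globalErgotropy, localErgotropy,
          h.globalMin_eq h.isSymplecticSpectrum_one, h.localMin_eq hν hμ,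
          ENNReal.toReal_ofReal (by linarith), ENNReal.toReal_ofReal (by linarith)]
        ring
    _ = (∑ j, (ν j - 1) + ∑ k, (μ k - 1)) / 2 := by
        simp only [Finset.sum_sub_distrib, Fintype.sum_sum_type, Pi.one_apply]
        ring
    _ = ∑ j, (ν j - 1) := by rw [hcomplement, add_self_div_two]

end LocalMinima

section Entropy

theorem sum_log_le_sum_sub_one {ι : Type*} [Fintype ι] {ν : ι → ℝ}
    (hν : ∀ j, 0 < ν j) : ∑ j, Real.log (ν j) ≤ ∑ j, (ν j - 1) :=
  Finset.sum_le_sum fun j _ => Real.log_le_sub_one_of_pos (hν j)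

theorem sum_log_eq_sum_sub_one_iff {ι : Type*} [Fintype ι] {ν : ι → ℝ} (hν : ∀ j, 0 < ν j) :
    ∑ j, Real.log (ν j) = ∑ j, (ν j - 1) ↔ ν = 1 := by
  rw [Finset.sum_eq_sum_iff_of_le fun j _ => Real.log_le_sub_one_of_pos (hν j)]
  refine ⟨fun h => funext fun j => ?_, fun h j _ => by simp [h]⟩
  by_contra hne
  exact (Real.log_lt_sub_one_of_pos (hν j) hne).ne (h j (Finset.mem_univ j))

variable {ι κ : Type} [Fintype ι] [DecidableEq ι] [Fintype κ] {ψ : L2 (ι ⊕ κ)}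
  {V : Matrix (Phase (ι ⊕ κ)) (Phase (ι ⊕ κ)) ℝ} {d : Phase (ι ⊕ κ) → ℝ} {ν : ι → ℝ}

theorem HasGaussianChar.renyiTwo_eq (h : HasGaussianChar ψ V d)
    (hν : IsSymplecticSpectrum (leftBlock V) ν) : renyiTwo ψ = ∑ j, Real.log (ν j) := by
  rw [renyiTwo, h.reducedPurity_eq, hν.det_eq, Real.sqrt_sq (Finset.prod_nonneg fun j _ =>
    (hν.1 j).le), Real.log_inv, neg_neg, Real.log_prod fun j _ => (hν.1 j).ne']

end Entropy

section Product

variable {ι κ : Type} [Fintype ι] [Fintype κ] {ψ : L2 (ι ⊕ κ)}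
  {V : Matrix (Phase (ι ⊕ κ)) (Phase (ι ⊕ κ)) ℝ} {ν : ι → ℝ} {μ : κ → ℝ}

theorem IsTensor.hasGaussianChar_left {f : L2 ι} {g : L2 κ} (hfg : IsTensor ψ f g)
    (h : HasGaussianChar ψ V 0) : HasGaussianChar ((‖g‖ : ℂ) • f) (leftBlock V) 0 := by
  refine ⟨h.1.submatrix _, fun ξ => ?_⟩
  have hξ := h.2 (Sum.elim (Sum.elim (ξ ∘ Sum.inl) 0) (Sum.elim (ξ ∘ Sum.inr) 0))
  have hleft : Sum.elim (Sum.elim (ξ ∘ Sum.inl) (0 : κ → ℝ)) (Sum.elim (ξ ∘ Sum.inr) 0) ∘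
      Sum.map Sum.inl (Sum.inl : ι → ι ⊕ κ) = ξ := by ext (k | k) <;> rfl
  have hright : Sum.elim (Sum.elim (ξ ∘ Sum.inl) (0 : κ → ℝ)) (Sum.elim (ξ ∘ Sum.inr) 0) ∘
      Sum.map Sum.inr (Sum.inr : κ → ι ⊕ κ) = 0 := by ext (k | k) <;> rfl
  rw [dotProduct_zero, ← dotProduct_leftBlock_mulVec, hfg.inner_eq (hfg.map_weyl _), hleft,
    hright, weyl_zero, inner_self_eq_norm_sq_to_K] at hξ
  rw [weyl_smul, inner_smul_left, inner_smul_right, dotProduct_zero, ← hξ, Complex.conj_ofReal]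
  simp only [Complex.coe_algebraMap]
  ring

variable [DecidableEq ι]

theorem HasGaussianChar.spectrum_eq_one_of_isProduct (h : HasGaussianChar ψ V 0)
    (hν : IsSymplecticSpectrum (leftBlock V) ν) (hψ : IsProduct ψ) : ν = 1 := by
  classical
  obtain ⟨f, g, hfg⟩ := hψ
  have hrenyi := h.renyiTwo_eq hν
  rw [renyiTwo, h.reducedPurity_eq, (hfg.hasGaussianChar_left h).det_eq_one, Real.sqrt_one,
    inv_one, Real.log_one, neg_zero, eq_comm, Finset.sum_eq_zero_iff_of_nonneg fun j _ =>
      Real.log_nonneg (h.uncertainty_leftBlock.one_le hν j)] at hrenyi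
  exact funext fun j => Real.eq_one_of_pos_of_log_eq_zero (hν.1 j) (hrenyi j (Finset.mem_univ j))

theorem HasGaussianChar.eq_smul_vac {φ : L2 ι} (h : HasGaussianChar φ 1 0) :
    φ = (inner ℂ (vac ι) φ : ℂ) • vac ι :=
  eq_smul_of_inner_weyl_eq h.norm_eq_one fun ξ => (h.2 ξ).trans (hasGaussianChar_vac.2 ξ).symm

theorem isProduct_of_isProduct_triUnitary [DecidableEq κ] {L C : Matrix ι ι ℝ}
    {L' C' : Matrix κ κ ℝ} (hL : IsUnit L.det) (hL' : IsUnit L'.det)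
    (h : IsProduct (triUnitary (isUnit_det_fromBlocks hL hL') (fromBlocks C 0 0 C') ψ)) :
    IsProduct ψ := by
  obtain ⟨f, g, hfg⟩ := h
  have hinv := (isTensor_tensor ((triUnitary hL C).symm f)
    ((triUnitary hL' C').symm g)).map_triUnitary (C := C) (C' := C') hL hL'
  rw [LinearIsometryEquiv.apply_symm_apply, LinearIsometryEquiv.apply_symm_apply] at hinv
  rw [(triUnitary (isUnit_det_fromBlocks hL hL') (fromBlocks C 0 0 C')).injective
    (hfg.unique hinv)]
  exact ⟨_, _, isTensor_tensor _ _⟩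

/- A local Gaussian unitary minimizing the energy takes the state to the vacuum. -/
theorem HasGaussianChar.isProduct_of_spectrum_eq_one (h : HasGaussianChar ψ V 0)
    (hν : IsSymplecticSpectrum (leftBlock V) 1) : IsProduct ψ := by
  classical
  obtain ⟨μ, hμ⟩ := exists_isSymplecticSpectrum h.posDef_rightBlock
  obtain ⟨L, C, L', C', hL, hC, hL', hC', htrace⟩ := exists_triMat_fromBlocks_trace_eq h.1 hν hμ
  have hcomplement := sum_sub_one_eq_of_isSymplecticSpectrum h.1 h.mem_symplecticGroup hν hμ
  have hU := h.map_triUnitary (isUnit_det_fromBlocks hL hL') (hC.fromBlocks transpose_zero hC')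
  obtain ⟨S, hS, hSV⟩ := hU.exists_eq_mul_transpose
  have hone : S * Sᵀ = 1 := by
    refine mul_transpose_eq_one_of_trace_eq hS ?_
    simp only [Pi.one_apply, sub_self, Finset.sum_const_zero, Finset.sum_sub_distrib,
      Finset.sum_const, Finset.card_univ, nsmul_eq_mul, mul_one] at hcomplement htrace
    rw [← hSV, htrace, Fintype.card_sum, Nat.cast_add]
    linarith
  rw [hSV, hone] at hU
  refine isProduct_of_isProduct_triUnitary (C := C) (C' := C') hL hL' ?_
  rw [hU.eq_smul_vac, ← mul_one (inner ℂ _ _)]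
  exact ⟨_, _, isTensor_vac.smul _ 1⟩

end Product

section Extension

variable {ι κ τ τ' : Type*} [DecidableEq ι] [DecidableEq κ] [Fintype τ] [DecidableEq τ]
  [Fintype τ'] [DecidableEq τ']

/-- The matrix that acts as `A` on the coordinates selected by `e` and as the identity on the
others, for injective `e`. -/
def extendMat (e : τ → ι) (A : Matrix τ τ ℝ) : Matrix ι ι ℝ :=
  1 + (1 : Matrix ι ι ℝ).submatrix id e * (A - 1) * (1 : Matrix ι ι ℝ).submatrix e id

theorem extendMat_transpose (e : τ → ι) (A : Matrix τ τ ℝ) :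
    (extendMat e A)ᵀ = extendMat e Aᵀ := by
  simp only [extendMat, transpose_add, transpose_mul, transpose_sub, transpose_one,
    transpose_submatrix, Matrix.mul_assoc]

theorem extendMat_one (e : τ → ι) : extendMat e (1 : Matrix τ τ ℝ) = 1 := by
  rw [extendMat, sub_self, Matrix.mul_zero, Matrix.zero_mul, add_zero]

theorem extendMat_mul [Fintype ι] {e : τ → ι} (he : Function.Injective e) (A B : Matrix τ τ ℝ) :
    extendMat e A * extendMat e B = extendMat e (A * B) := by
  have hsection (Z : Matrix τ ι ℝ) : (1 : Matrix ι ι ℝ).submatrix e id *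
      ((1 : Matrix ι ι ℝ).submatrix id e * Z) = Z := by
    rw [← Matrix.mul_assoc, ← submatrix_mul _ _ _ _ _ Function.bijective_id, Matrix.one_mul,
      submatrix_one e he, Matrix.one_mul]
  simp only [extendMat, Matrix.mul_add, Matrix.add_mul, Matrix.mul_sub, Matrix.sub_mul,
    Matrix.mul_one, Matrix.one_mul, Matrix.mul_assoc, hsection]
  abel

theorem extendMat_diagonal {e : τ → ι} (he : Function.Injective e) (v : τ → ℝ) :
    extendMat e (diagonal v) = diagonal (Function.extend e v 1) := by
  ext i j
  by_cases hi : ∃ t, e t = i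
  · obtain ⟨t, rfl⟩ := hi
    by_cases hj : e t = j
    · subst hj
      simp [extendMat, mul_apply, Matrix.one_apply, diagonal_apply, he.eq_iff, he.extend_apply]
    · have hsupport (t' : τ) (h : e t' = j) : ¬ t = t' := fun ht => hj (ht ▸ h)
      simp +contextual [extendMat, mul_apply, Matrix.one_apply, diagonal_apply, he.eq_iff, hj,
        hsupport]
  · have hi' (t : τ) : ¬ i = e t := fun h => hi ⟨t, h.symm⟩
    simp [extendMat, mul_apply, Matrix.one_apply, diagonal_apply, hi',
      Function.extend_apply' _ _ _ hi]

theorem toBlocks₁₁_extendMat_sumMap (e : τ → ι) (e' : τ' → κ)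
    (A : Matrix (τ ⊕ τ') (τ ⊕ τ') ℝ) :
    (extendMat (Sum.map e e') A).toBlocks₁₁ = extendMat e A.toBlocks₁₁ := by
  ext i j
  simp [extendMat, toBlocks₁₁, mul_apply, Matrix.one_apply, Fintype.sum_sum_type]

end Extension

section Squeezing

variable {ι κ τ : Type}

theorem leftBlock_fromBlocks (X Y : Matrix (ι ⊕ κ) (ι ⊕ κ) ℝ) :
    leftBlock (fromBlocks X 0 0 Y) = fromBlocks X.toBlocks₁₁ 0 0 Y.toBlocks₁₁ := by
  ext (i | i) (j | j) <;> rfl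

theorem exists_mul_self_sub_mul_self_eq_one {ν : τ → ℝ} (hν : ∀ t, 1 ≤ ν t) :
    ∃ c s : τ → ℝ, c * c - s * s = 1 ∧ c * c + s * s = ν := by
  have hc (t : τ) : √((ν t + 1) / 2) * √((ν t + 1) / 2) = (ν t + 1) / 2 :=
    Real.mul_self_sqrt (by linarith [hν t])
  have hs (t : τ) : √((ν t - 1) / 2) * √((ν t - 1) / 2) = (ν t - 1) / 2 :=
    Real.mul_self_sqrt (by linarith [hν t])
  refine ⟨fun t => √((ν t + 1) / 2), fun t => √((ν t - 1) / 2), funext fun t => ?_,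
    funext fun t => ?_⟩
  · simp only [Pi.sub_apply, Pi.mul_apply, Pi.one_apply, hc, hs]
    ring
  · simp only [Pi.add_apply, Pi.mul_apply, hc, hs]
    ring

section SqueezeMat

variable [DecidableEq τ]

/-- The action on the positions of two-mode squeezers, one for each `t : τ`, with
`c t = cosh r` and `s t = sinh r` for the squeezing parameter `r` of the pair `t`. -/
def squeezeMat (c s : τ → ℝ) : Matrix (τ ⊕ τ) (τ ⊕ τ) ℝ :=
  fromBlocks (diagonal c) (diagonal s) (diagonal s) (diagonal c)

theorem squeezeMat_transpose (c s : τ → ℝ) : (squeezeMat c s)ᵀ = squeezeMat c s := by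
  simp only [squeezeMat, fromBlocks_transpose, diagonal_transpose]

theorem squeezeMat_mul_squeezeMat_neg [Fintype τ] {c s : τ → ℝ} (h : c * c - s * s = 1) :
    squeezeMat c s * squeezeMat c (-s) = 1 := by
  have hneg : diagonal (-s) = -diagonal s := (diagonal_neg s).symm
  have hdiag : diagonal c * diagonal c - diagonal s * diagonal s = 1 := by
    rw [diagonal_mul_diagonal', diagonal_mul_diagonal', diagonal_sub, ← diagonal_one]
    exact congrArg diagonal h
  have hoff : diagonal c * diagonal s = diagonal s * diagonal c := commute_diagonal c s
  simp only [squeezeMat, fromBlocks_multiply, hneg, mul_neg, hoff, neg_add_cancel, add_neg_cancel,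
    ← sub_eq_add_neg, neg_add_eq_sub, hdiag, fromBlocks_one]

theorem toBlocks₁₁_squeezeMat_mul_self [Fintype τ] (c s : τ → ℝ) :
    (squeezeMat c s * squeezeMat c s).toBlocks₁₁ = diagonal (c * c + s * s) := by
  rw [squeezeMat, fromBlocks_multiply, toBlocks_fromBlocks₁₁, diagonal_mul_diagonal',
    diagonal_mul_diagonal', diagonal_add]
  rfl

theorem toBlocks₁₁_extendMat_squeezeMat_mul_self [Fintype τ] [Fintype ι] [DecidableEq ι]
    [Fintype κ] [DecidableEq κ] (e : τ ↪ ι) (e' : τ ↪ κ) (c s : τ → ℝ) :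
    (extendMat (Sum.map e e') (squeezeMat c s) *
      extendMat (Sum.map e e') (squeezeMat c s)).toBlocks₁₁ =
        diagonal (Function.extend e (c * c + s * s) 1) := by
  rw [extendMat_mul (e.injective.sumMap e'.injective), toBlocks₁₁_extendMat_sumMap,
    toBlocks₁₁_squeezeMat_mul_self, extendMat_diagonal e.injective]

end SqueezeMat

variable [Fintype ι] [DecidableEq ι] [Fintype κ]

theorem exists_hasGaussianChar_isSymplecticSpectrum [Finite τ] (e : τ ↪ ι) (e' : τ ↪ κ)
    {ν : τ → ℝ} (hν : ∀ t, 1 ≤ ν t) :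
    ∃ (ψ : L2 (ι ⊕ κ)) (V : Matrix (Phase (ι ⊕ κ)) (Phase (ι ⊕ κ)) ℝ), HasGaussianChar ψ V 0 ∧
      IsSymplecticSpectrum (leftBlock V) (Function.extend e ν 1) := by
  classical
  have := Fintype.ofFinite τ
  obtain ⟨c, s, hsub, hadd⟩ := exists_mul_self_sub_mul_self_eq_one hν
  let K := extendMat (Sum.map e e') (squeezeMat c s)
  let L := extendMat (Sum.map e e') (squeezeMat c (-s))
  have hKL : K * L = 1 := by
    rw [extendMat_mul (e.injective.sumMap e'.injective), squeezeMat_mul_squeezeMat_neg hsub,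
      extendMat_one]
  have hcov : triMat L 0 * 1 * (triMat L 0)ᵀ = fromBlocks (K * K) 0 0 (L * L) := by
    simp [triMat, inv_eq_left_inv hKL, fromBlocks_transpose, fromBlocks_multiply, K, L,
      extendMat_transpose, squeezeMat_transpose]
  refine ⟨_, _, hasGaussianChar_vac.map_triUnitary (isUnit_det_of_left_inverse hKL) isSymm_zero,
    fun j => ?_, 1, one_mem _, ?_⟩
  · rcases em (∃ t, e t = j) with ⟨t, rfl⟩ | hj
    · exact e.injective.extend_apply ν 1 t ▸ zero_lt_one.trans_le (hν t)
    · rw [Function.extend_apply' _ _ _ hj]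
      exact zero_lt_one
  · rw [hcov, leftBlock_fromBlocks, toBlocks₁₁_extendMat_squeezeMat_mul_self,
      toBlocks₁₁_extendMat_squeezeMat_mul_self, neg_mul_neg, hadd, Matrix.one_mul,
      transpose_one, Matrix.mul_one]

variable [DecidableEq κ]

theorem exists_isPureGaussian_renyiTwo_ergotropicGap [Fintype τ] (e : τ ↪ ι) (e' : τ ↪ κ)
    {ν : τ → ℝ} (hν : ∀ t, 1 ≤ ν t) : ∃ ψ : L2 (ι ⊕ κ), IsPureGaussian ψ ∧
      renyiTwo ψ = ∑ t, Real.log (ν t) ∧ ergotropicGap ψ = ∑ t, (ν t - 1) := by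
  obtain ⟨ψ, V, hψ, hspec⟩ := exists_hasGaussianChar_isSymplecticSpectrum e e' hν
  obtain ⟨μ, hμ⟩ := exists_isSymplecticSpectrum hψ.posDef_rightBlock
  have hsum {F : ℝ → ℝ} (hF : F 1 = 0) : ∑ j, F (Function.extend e ν 1 j) = ∑ t, F (ν t) := by
    symm
    refine Fintype.sum_of_injective e e.injective _ _ (fun j hj => ?_) fun t => ?_
    · rw [Function.extend_apply' _ _ _ hj, Pi.one_apply, hF]
    · rw [e.injective.extend_apply]
  refine ⟨ψ, isPureGaussian_iff_exists_hasGaussianChar.2 ⟨V, hψ⟩, ?_, ?_⟩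
  · rw [hψ.renyiTwo_eq hspec, hsum Real.log_one]
  · rw [hψ.ergotropicGap_eq hspec hμ, hsum (F := fun x => x - 1) (sub_self 1)]

theorem exists_isPureGaussian_two_squeezed (hι : 2 ≤ Fintype.card ι) (hκ : 2 ≤ Fintype.card κ)
    {a b : ℝ} (ha : 1 ≤ a) (hb : 1 ≤ b) : ∃ ψ : L2 (ι ⊕ κ), IsPureGaussian ψ ∧
      renyiTwo ψ = Real.log a + Real.log b ∧ ergotropicGap ψ = (a - 1) + (b - 1) := by
  obtain ⟨e⟩ : Nonempty (Fin 2 ↪ ι) := Function.Embedding.nonempty_of_card_le (by simpa)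
  obtain ⟨e'⟩ : Nonempty (Fin 2 ↪ κ) := Function.Embedding.nonempty_of_card_le (by simpa)
  obtain ⟨ψ, hψ, hS, hδ⟩ := exists_isPureGaussian_renyiTwo_ergotropicGap e e' (ν := ![a, b])
    (Fin.forall_fin_two.2 ⟨ha, hb⟩)
  exact ⟨ψ, hψ, hS.trans (Fin.sum_univ_two _), hδ.trans (Fin.sum_univ_two _)⟩

/- The first state spreads the entropy evenly over two modes, the second puts all of it in one. -/
theorem exists_renyiTwo_eq_and_ergotropicGap_ne (hι : 2 ≤ Fintype.card ι)
    (hκ : 2 ≤ Fintype.card κ) {C : ℝ} (hC : 1 < C) :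
    ∃ ψ φ : L2 (ι ⊕ κ), IsPureGaussian ψ ∧ IsPureGaussian φ ∧
      renyiTwo ψ = Real.log C ∧ renyiTwo φ = Real.log C ∧
      ergotropicGap ψ = 2 * (√C - 1) ∧ ergotropicGap φ = C - 1 ∧
      ergotropicGap ψ ≠ ergotropicGap φ := by
  have hsqrt : 1 < √C := Real.lt_sqrt_of_sq_lt (by linarith)
  have hsq : √C ^ 2 = C := Real.sq_sqrt (by linarith)
  obtain ⟨ψ, hψ, hψS, hψδ⟩ := exists_isPureGaussian_two_squeezed hι hκ hsqrt.le hsqrt.le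
  obtain ⟨φ, hφ, hφS, hφδ⟩ := exists_isPureGaussian_two_squeezed hι hκ hC.le le_rfl
  refine ⟨ψ, φ, hψ, hφ, ?_, ?_, ?_, ?_, fun h => ?_⟩
  · rw [hψS, Real.log_sqrt (by linarith), add_halves]
  · rw [hφS, Real.log_one, add_zero]
  · rw [hψδ, two_mul]
  · rw [hφδ, sub_self, add_zero]
  · have hgap : (√C - 1) ^ 2 = 0 := by linarith
    exact (pow_pos (sub_pos.2 hsqrt) 2).ne' hgap

theorem not_exists_ergotropicGap_eq_comp_renyiTwo (hι : 2 ≤ Fintype.card ι)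
    (hκ : 2 ≤ Fintype.card κ) : ¬ ∃ F : ℝ → ℝ, ∀ ψ : L2 (ι ⊕ κ), IsPureGaussian ψ →
      ergotropicGap ψ = F (renyiTwo ψ) := by
  rintro ⟨F, hF⟩
  obtain ⟨ψ, φ, hψ, hφ, hψS, hφS, -, -, hne⟩ :=
    exists_renyiTwo_eq_and_ergotropicGap_ne hι hκ one_lt_two
  exact hne (by rw [hF ψ hψ, hF φ hφ, hψS, hφS])

/- The spectra `(2, 2)` and `(3, 1)` have the same sum but different products. -/
theorem not_exists_renyiTwo_eq_comp_ergotropicGap (hι : 2 ≤ Fintype.card ι)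
    (hκ : 2 ≤ Fintype.card κ) : ¬ ∃ G : ℝ → ℝ, ∀ ψ : L2 (ι ⊕ κ), IsPureGaussian ψ →
      renyiTwo ψ = G (ergotropicGap ψ) := by
  rintro ⟨G, hG⟩
  obtain ⟨ψ, hψ, hψS, hψδ⟩ :=
    exists_isPureGaussian_two_squeezed hι hκ one_le_two (one_le_two (α := ℝ))
  obtain ⟨φ, hφ, hφS, hφδ⟩ :=
    exists_isPureGaussian_two_squeezed hι hκ (a := 3) (b := 1) (by norm_num) le_rfl
  have hgap : ergotropicGap ψ = ergotropicGap φ := by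
    rw [hψδ, hφδ]
    norm_num
  have hlog : Real.log (2 * 2) = Real.log 3 := by
    rw [Real.log_mul two_ne_zero two_ne_zero, ← hψS, hG ψ hψ, hgap, ← hG φ hφ, hφS, Real.log_one,
      add_zero]
  have := Real.log_injOn_pos (Set.mem_Ioi.2 (by norm_num)) (Set.mem_Ioi.2 (by norm_num)) hlog
  norm_num at this

end Squeezing

end GaussianErgotropy

theorem mainTheorem3_general {ι κ : Type} [Fintype ι] [DecidableEq ι] [Fintype κ]
    [DecidableEq κ] :
    (∀ ψ : L2 (ι ⊕ κ), IsPureGaussian ψ →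
      (energy ψ ≠ ⊤ ∧
        (∃ U, IsGaussianUnitary U ∧ energy (U ψ) = globalMin ψ) ∧
        (∃ U, IsLocalGaussianUnitary U ∧ energy (U ψ) = localMin ψ)) ∧
      (∃ ν : ι → ℝ, IsSymplecticSpectrum (reducedCov ψ) ν ∧ (∀ j, 1 ≤ ν j) ∧
        renyiTwo ψ = ∑ j, Real.log (ν j) ∧ ergotropicGap ψ = ∑ j, (ν j - 1)) ∧
      renyiTwo ψ ≤ ergotropicGap ψ ∧
      (renyiTwo ψ = ergotropicGap ψ ↔ IsProduct ψ)) ∧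
    (2 ≤ Fintype.card ι → 2 ≤ Fintype.card κ →
      (∀ C : ℝ, 1 < C → ∃ ψ φ : L2 (ι ⊕ κ), IsPureGaussian ψ ∧ IsPureGaussian φ ∧
        renyiTwo ψ = Real.log C ∧ renyiTwo φ = Real.log C ∧
        ergotropicGap ψ = 2 * (√C - 1) ∧ ergotropicGap φ = C - 1 ∧
        ergotropicGap ψ ≠ ergotropicGap φ) ∧
      (¬ ∃ F : ℝ → ℝ, ∀ ψ : L2 (ι ⊕ κ), IsPureGaussian ψ →
        ergotropicGap ψ = F (renyiTwo ψ)) ∧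
      (¬ ∃ G : ℝ → ℝ, ∀ ψ : L2 (ι ⊕ κ), IsPureGaussian ψ →
        renyiTwo ψ = G (ergotropicGap ψ))) := by
  refine ⟨fun ψ hψ => ?_, fun hι hκ => ⟨fun C => exists_renyiTwo_eq_and_ergotropicGap_ne hι hκ,
    not_exists_ergotropicGap_eq_comp_renyiTwo hι hκ,
    not_exists_renyiTwo_eq_comp_ergotropicGap hι hκ⟩⟩
  obtain ⟨V, hV⟩ := isPureGaussian_iff_exists_hasGaussianChar.1 hψ
  obtain ⟨ν, hν⟩ := exists_isSymplecticSpectrum hV.posDef_leftBlock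
  obtain ⟨μ, hμ⟩ := exists_isSymplecticSpectrum hV.posDef_rightBlock
  have hS := hV.renyiTwo_eq hν
  have hδ := hV.ergotropicGap_eq hν hμ
  have hred : reducedCov ψ = leftBlock V := congrArg leftBlock hV.covMatrix_eq
  obtain ⟨U, hU, hUmin⟩ := hV.exists_isGaussianUnitary_energy_eq hV.isSymplecticSpectrum_one
  obtain ⟨W, hW, hWmin⟩ := hV.exists_isLocalGaussianUnitary_energy_eq hν hμ
  refine ⟨⟨hV.energy_ne_top, ⟨U, hU, ?_⟩, ⟨W, hW, ?_⟩⟩, ⟨ν, hred ▸ hν, ?_, hS, hδ⟩, ?_, ?_⟩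
  · rw [hUmin, hV.globalMin_eq hV.isSymplecticSpectrum_one]
  · rw [hWmin, hV.localMin_eq hν hμ]
  · exact hV.uncertainty_leftBlock.one_le hν
  · rw [hS, hδ]
    exact sum_log_le_sum_sub_one hν.1
  · rw [hS, hδ, sum_log_eq_sum_sub_one_iff hν.1]
    refine ⟨fun h => ?_, hV.spectrum_eq_one_of_isProduct hν⟩
    exact hV.isProduct_of_spectrum_eq_one (h ▸ hν)

theorem mainTheorem3 (m₁ m₂ : ℕ) (h₁ : 1 ≤ m₁) (h₁₂ : m₁ ≤ m₂) :
    (∀ ψ : L2 (Fin m₁ ⊕ Fin m₂), IsPureGaussian ψ →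
      -- the energies are finite and the minima in the ergotropies are attained
      (energy ψ ≠ ⊤ ∧
        (∃ U, IsGaussianUnitary U ∧ energy (U ψ) = globalMin ψ) ∧
        (∃ U, IsLocalGaussianUnitary U ∧ energy (U ψ) = localMin ψ)) ∧
      -- both quantities in terms of the symplectic eigenvalues of the first subsystem
      (∃ ν : Fin m₁ → ℝ, IsSymplecticSpectrum (reducedCov ψ) ν ∧ (∀ j, 1 ≤ ν j) ∧
        renyiTwo ψ = ∑ j, Real.log (ν j) ∧ ergotropicGap ψ = ∑ j, (ν j - 1)) ∧
      renyiTwo ψ ≤ ergotropicGap ψ ∧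
      (renyiTwo ψ = ergotropicGap ψ ↔ IsProduct ψ)) ∧
    -- functional independence
    (2 ≤ m₁ →
      (∀ C : ℝ, 1 < C → ∃ ψ φ : L2 (Fin m₁ ⊕ Fin m₂), IsPureGaussian ψ ∧ IsPureGaussian φ ∧
        renyiTwo ψ = Real.log C ∧ renyiTwo φ = Real.log C ∧
        ergotropicGap ψ = 2 * (√C - 1) ∧ ergotropicGap φ = C - 1 ∧
        ergotropicGap ψ ≠ ergotropicGap φ) ∧
      (¬ ∃ F : ℝ → ℝ, ∀ ψ : L2 (Fin m₁ ⊕ Fin m₂), IsPureGaussian ψ →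
        ergotropicGap ψ = F (renyiTwo ψ)) ∧
      (¬ ∃ G : ℝ → ℝ, ∀ ψ : L2 (Fin m₁ ⊕ Fin m₂), IsPureGaussian ψ →
        renyiTwo ψ = G (ergotropicGap ψ))) := by
  obtain ⟨hpure, hindep⟩ := mainTheorem3_general (ι := Fin m₁) (κ := Fin m₂)
  exact ⟨hpure, fun h => hindep (by simpa) (by simpa using h.trans h₁₂)⟩
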